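/- Let $N\ge 1$ and $n\ge 0$ be integers and let $\Omega\subset\mathbb{R}^N$ be a bounded domain (a bounded, connected, nonempty open set). For $l=0,\dots,n$ let $f_l:[0,\infty)^{n+1}\to\mathbb{R}$ be Lebesgue measurable functions such that: (a) there are real constants $C_{l,j}$, exponents $0<p_{l,j}<1$ and $A\ge 0$ with $$|f_l(z_0,\dots,z_n)|\le \sum_{j=0}^n C_{l,j}|z_j|^{p_{l,j}}+A\qquad\text{for all } z\in[0,\infty)^{n+1};$$ (b) there are $\epsilon_0>0$, constants $A_{l,j}\ge 0$ such that for each $l$ at least one $A_{l,j}$ is nonzero, and exponents $0<\alpha_{l,j}<1$, with $$f_l(z_0,\dots,z_n)\ge\sum_{j=0}^n A_{l,j}|z_j|^{\alpha_{l,j}}\qquad\text{whenever } z\in[0,\infty)^{n+1},\ |z_j|<\epsilon_0 \text{ for } j=0,\dots,n;$$ (c) if $0\le y_j\le z_j$ for $j=0,\dots,n$, then $f_l(y_0,\dots,y_n)\le f_l(z_0,\dots,z_n)$; (d) if $(z_{j,k})_{k\ge 1}$, $j=0,\dots,n$, are nondecreasing sequences of nonnegative real numbers with $z_{j,k}\uparrow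 z_j<\infty$, then $\lim_{k\to\infty} f_l(z_{0,k},\dots,z_{n,k})=f_l(z_0,\dots,z_n)$. Let $\lambda_0,\dots,\lambda_n\in L^\infty(\Omega)$ with $\lambda_l\ge 0$ a.e., and suppose that there are a point $q\in\Omega$ and numbers $\rho>0$, $\Lambda>0$ such that $\lambda_l\ge\Lambda$ a.e. in $B_{2\rho}(q)\cap\Omega$ for every $l=0,\dots,n$. Then the Dirichlet problem $$-\Delta u_l=\lambda_l(x)\,f_l(u_0,\dots,u_n)\ \text{ in }\Omega,\qquad u_l=0\ \text{ on }\partial\Omega,\qquad l=0,\dots,n,$$ has a nonnegative weak solution no component of which vanishes identically: there is $(u_0,\dots,u_n)\in W_0^{1,2}(\Omega)^{n+1}\cap L^\infty(\Omega)^{n+1}$ such that, for every $l$, $u_l\ge 0$ a.e. in $\Omega$, $u_l$ is not a.e. equal to $0$ in $\Omega$, and $$\int_\Omega\nabla u_l\cdot\nabla\varphi\,dx=\int_\Omega\lambda_l\,f_l(u_0,\dots,u_n)\,\varphi\,dx\qquad\text{for all }\varphi\in C_c^\infty(\Omega),$$ the integrand on the right being integrable. -/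

import Mathlib

open MeasureTheory Filter Topology TopologicalSpace
open scoped ENNReal ContDiff Distributions

/-- `G` is the weak gradient of `u` on the open set `Ω`: for every direction `v` and every smooth
function `φ` with compact support in `Ω`, `∫_Ω u ∂_v φ = - ∫_Ω (G · v) φ`. -/
structure HasWeakGradient {N : ℕ} (Ω : Opens (EuclideanSpace ℝ (Fin N)))
    (u : EuclideanSpace ℝ (Fin N) → ℝ)
    (G : EuclideanSpace ℝ (Fin N) → EuclideanSpace ℝ (Fin N)) : Prop where
  locallyIntegrableOn : LocallyIntegrableOn u (Ω : Set (EuclideanSpace ℝ (Fin N))) volume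
  locallyIntegrableOn_grad : LocallyIntegrableOn G (Ω : Set (EuclideanSpace ℝ (Fin N))) volume
  integral_eq : ∀ (φ : 𝓓(Ω, ℝ)) (v : EuclideanSpace ℝ (Fin N)),
    ∫ x in (Ω : Set (EuclideanSpace ℝ (Fin N))), u x * fderiv ℝ φ x v
      = - ∫ x in (Ω : Set (EuclideanSpace ℝ (Fin N))), inner ℝ (G x) v * φ x

/-- `u` belongs to the Sobolev space `W^{1,2}(Ω)`, with weak gradient `G`. -/
structure IsW12 {N : ℕ} (Ω : Opens (EuclideanSpace ℝ (Fin N)))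
    (u : EuclideanSpace ℝ (Fin N) → ℝ)
    (G : EuclideanSpace ℝ (Fin N) → EuclideanSpace ℝ (Fin N)) : Prop where
  memLp : MemLp u 2 (volume.restrict (Ω : Set (EuclideanSpace ℝ (Fin N))))
  memLp_grad : MemLp G 2 (volume.restrict (Ω : Set (EuclideanSpace ℝ (Fin N))))
  hasWeakGradient : HasWeakGradient Ω u G

/-- `u` belongs to `W₀^{1,2}(Ω)`, the closure of the smooth functions with compact support in `Ω`
in the norm of `W^{1,2}(Ω)`, and has weak gradient `G`. -/
structure IsW012 {N : ℕ} (Ω : Opens (EuclideanSpace ℝ (Fin N)))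
    (u : EuclideanSpace ℝ (Fin N) → ℝ)
    (G : EuclideanSpace ℝ (Fin N) → EuclideanSpace ℝ (Fin N)) : Prop extends IsW12 Ω u G where
  exists_approx : ∃ φ : ℕ → 𝓓(Ω, ℝ),
    Tendsto (fun k => eLpNorm (fun x => φ k x - u x) 2
      (volume.restrict (Ω : Set (EuclideanSpace ℝ (Fin N))))) atTop (𝓝 0) ∧
    Tendsto (fun k => eLpNorm (fun x => gradient (φ k) x - G x) 2
      (volume.restrict (Ω : Set (EuclideanSpace ℝ (Fin N))))) atTop (𝓝 0)

/-- `(u₀, …, uₙ) ∈ W₀^{1,2}(Ω)^{n+1} ∩ L^∞(Ω)^{n+1}` is a weak solution of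
`-Δ u_l = lam_l(x) f_l(u₀, …, uₙ)` in `Ω`, `u_l = 0` on `∂Ω`, for `l = 0, …, n`. -/
def IsWeakSolution {N n : ℕ} (Ω : Opens (EuclideanSpace ℝ (Fin N)))
    (lam : Fin (n + 1) → EuclideanSpace ℝ (Fin N) → ℝ)
    (f : Fin (n + 1) → (Fin (n + 1) → ℝ) → ℝ)
    (u : Fin (n + 1) → EuclideanSpace ℝ (Fin N) → ℝ) : Prop :=
  ∃ G : Fin (n + 1) → EuclideanSpace ℝ (Fin N) → EuclideanSpace ℝ (Fin N), ∀ l,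
    IsW012 Ω (u l) (G l) ∧
    MemLp (u l) ∞ (volume.restrict (Ω : Set (EuclideanSpace ℝ (Fin N)))) ∧
    ∀ φ : 𝓓(Ω, ℝ),
      IntegrableOn (fun x => lam l x * f l (fun j => u j x) * φ x)
        (Ω : Set (EuclideanSpace ℝ (Fin N))) volume ∧
      ∫ x in (Ω : Set (EuclideanSpace ℝ (Fin N))), inner ℝ (G l x) (gradient φ x)
        = ∫ x in (Ω : Set (EuclideanSpace ℝ (Fin N))), lam l x * f l (fun j => u j x) * φ x

/-- Measurability (in the sense of Lebesgue) and sublinear growth on the closed orthant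
`[0, ∞)^{n+1}`. -/
def SublinearGrowth {n : ℕ} (f : Fin (n + 1) → (Fin (n + 1) → ℝ) → ℝ) : Prop :=
  (∀ l, AEMeasurable (f l) (volume.restrict (Set.Ici (0 : Fin (n + 1) → ℝ)))) ∧
  ∃ (C p : Fin (n + 1) → Fin (n + 1) → ℝ) (A : ℝ),
    (∀ l j, 0 < p l j ∧ p l j < 1) ∧ 0 ≤ A ∧
    ∀ l, ∀ z : Fin (n + 1) → ℝ, 0 ≤ z → |f l z| ≤ ∑ j, C l j * |z j| ^ p l j + A

/-- Sublinear lower bound near the origin of the closed orthant `[0, ∞)^{n+1}`. -/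
def SublinearLowerBound {n : ℕ} (f : Fin (n + 1) → (Fin (n + 1) → ℝ) → ℝ) : Prop :=
  ∃ (ε₀ : ℝ) (A α : Fin (n + 1) → Fin (n + 1) → ℝ),
    0 < ε₀ ∧ (∀ l j, 0 ≤ A l j) ∧ (∀ l, ∃ j, A l j ≠ 0) ∧ (∀ l j, 0 < α l j ∧ α l j < 1) ∧
    ∀ l, ∀ z : Fin (n + 1) → ℝ, 0 ≤ z → (∀ j, |z j| < ε₀) → ∑ j, A l j * |z j| ^ α l j ≤ f l z

/-- Each `f_l` is nondecreasing (for the componentwise order) on `[0, ∞)^{n+1}`. -/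
def Cooperative {n : ℕ} (f : Fin (n + 1) → (Fin (n + 1) → ℝ) → ℝ) : Prop :=
  ∀ l, MonotoneOn (f l) (Set.Ici 0)

/-- Each `f_l` is continuous along componentwise nondecreasing convergent sequences in
`[0, ∞)^{n+1}`. -/
def MonotoneLeftContinuous {n : ℕ} (f : Fin (n + 1) → (Fin (n + 1) → ℝ) → ℝ) : Prop :=
  ∀ l, ∀ (z : ℕ → Fin (n + 1) → ℝ) (z' : Fin (n + 1) → ℝ), (∀ k, 0 ≤ z k) → Monotone z →
    Tendsto z atTop (𝓝 z') → Tendsto (fun k => f l (z k)) atTop (𝓝 (f l z'))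

/-! The proof is the method of sub- and supersolutions. Let S send g ∈ L²(Ω) to the solution u ∈
W₀^{1,2}(Ω) of -Δu = g (`exists_solution_operator`). By the weak maximum principle S preserves
order, so cooperativity makes T(U)_l = S(λ_l f_l(U)) order-preserving (after truncating U to [0,
M]). A fixed point of T with values in [0, M] solves the system.

Upper barrier: let |x| ≤ R on Ω and λ_l ≤ L. Comparison with a paraboloid gives S g ≤ c R² whenever
g ≤ c. Since the growth exponents are below 1, some large M has f_l ≤ B on [0, M]^{n+1} with R² L B
≤ M, so T never exceeds M (`fst_le_of_weak_equation`, `SublinearGrowth.exists_invariant_bound`).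

Lower barrier: the bump v = exp(-1/(r² - |x - q|²)) satisfies -Δv ≤ K v up to the edge of its
support (`exists_bump_neg_laplacian_le`). Since the exponents of the lower bound are below 1, K t ≤
Λ f_l(t, …, t) for small t, so for small ε the function εv is a subsolution in every component.

The iterates of T from (εv, …, εv) increase and stay below M. They converge a.e. and in L², left
continuity passes the limit through f_l, and continuity of S passes it through the equation. The
limit lies above εv, so no component vanishes. No regularity of ∂Ω is needed: the Poincaré
inequality and the comparison principle are obtained from test functions by density. -/

/-! ### Test functions, integration by parts and the Poincaré inequality -/

section TestFunctions

variable {N : ℕ} {Ω : Opens (EuclideanSpace ℝ (Fin N))}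

theorem TestFunction.eq_zero_of_notMem (φ : 𝓓(Ω, ℝ)) {x : EuclideanSpace ℝ (Fin N)}
    (hx : x ∉ Ω) : φ x = 0 :=
  image_eq_zero_of_notMem_tsupport fun h => hx (φ.tsupport_subset h)

theorem TestFunction.differentiable (φ : 𝓓(Ω, ℝ)) : Differentiable ℝ φ :=
  φ.contDiff.differentiable (by simp)

theorem TestFunction.continuous_fderiv (φ : 𝓓(Ω, ℝ)) : Continuous (fderiv ℝ φ) :=
  φ.contDiff.continuous_fderiv (by simp)

theorem TestFunction.continuous_gradient (φ : 𝓓(Ω, ℝ)) : Continuous (gradient φ) :=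
  (InnerProductSpace.toDual ℝ _).symm.continuous.comp φ.continuous_fderiv

theorem TestFunction.hasCompactSupport_gradient (φ : 𝓓(Ω, ℝ)) : HasCompactSupport (gradient φ) :=
  (φ.hasCompactSupport.fderiv ℝ).comp_left
    (g := (InnerProductSpace.toDual ℝ (EuclideanSpace ℝ (Fin N))).symm) (map_zero _)

theorem TestFunction.gradient_eq_zero_of_notMem (φ : 𝓓(Ω, ℝ)) {x : EuclideanSpace ℝ (Fin N)}
    (hx : x ∉ Ω) : gradient φ x = 0 := by
  have h : fderiv ℝ φ x = 0 :=
    image_eq_zero_of_notMem_tsupport fun h =>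
      hx (φ.tsupport_subset (tsupport_fderiv_subset ℝ h))
  simp [gradient, h]

theorem TestFunction.memLp (φ : 𝓓(Ω, ℝ)) (p : ℝ≥0∞) :
    MemLp φ p (volume.restrict (Ω : Set (EuclideanSpace ℝ (Fin N)))) :=
  (φ.continuous.memLp_of_hasCompactSupport φ.hasCompactSupport).restrict _

theorem TestFunction.memLp_gradient (φ : 𝓓(Ω, ℝ)) (p : ℝ≥0∞) :
    MemLp (gradient φ) p (volume.restrict (Ω : Set (EuclideanSpace ℝ (Fin N)))) :=
  (φ.continuous_gradient.memLp_of_hasCompactSupport φ.hasCompactSupport_gradient).restrict _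

theorem gradient_add_apply {f g : EuclideanSpace ℝ (Fin N) → ℝ} {x : EuclideanSpace ℝ (Fin N)}
    (hf : DifferentiableAt ℝ f x) (hg : DifferentiableAt ℝ g x) :
    gradient (f + g) x = gradient f x + gradient g x := by
  simp [gradient, fderiv_add hf hg]

theorem gradient_const_smul_apply {f : EuclideanSpace ℝ (Fin N) → ℝ}
    {x : EuclideanSpace ℝ (Fin N)} (hf : DifferentiableAt ℝ f x) (c : ℝ) :
    gradient (c • f) x = c • gradient f x := by
  simp [gradient, fderiv_const_smul hf]

/-- Integration by parts against a test function. -/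
theorem TestFunction.integral_mul_fderiv (φ : 𝓓(Ω, ℝ)) {F : EuclideanSpace ℝ (Fin N) → ℝ}
    (hF : ContDiff ℝ 1 F) (v : EuclideanSpace ℝ (Fin N)) :
    ∫ x in (Ω : Set (EuclideanSpace ℝ (Fin N))), F x * fderiv ℝ φ x v
      = - ∫ x in (Ω : Set (EuclideanSpace ℝ (Fin N))), fderiv ℝ F x v * φ x := by
  rw [setIntegral_eq_integral_of_forall_compl_eq_zero, setIntegral_eq_integral_of_forall_compl_eq_zero]
  · have hφ' : Continuous fun x => fderiv ℝ φ x v := φ.continuous_fderiv.clm_apply continuous_const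
    have hF' : Continuous fun x => fderiv ℝ F x v :=
      (hF.continuous_fderiv (by simp)).clm_apply continuous_const
    have hs : HasCompactSupport fun x => fderiv ℝ φ x v := φ.hasCompactSupport.fderiv_apply ℝ v
    refine integral_mul_fderiv_eq_neg_fderiv_mul_of_integrable ?_ ?_ ?_ ?_ ?_
    · exact (hF'.mul φ.continuous).integrable_of_hasCompactSupport φ.hasCompactSupport.mul_left
    · exact (hF.continuous.mul hφ').integrable_of_hasCompactSupport hs.mul_left
    · exact (hF.continuous.mul φ.continuous).integrable_of_hasCompactSupport
        φ.hasCompactSupport.mul_left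
    · exact fun x _ => (hF.differentiable (by simp)) x
    · exact fun x _ => φ.differentiable x
  · intro x hx
    simp [φ.eq_zero_of_notMem hx]
  · intro x hx
    have := φ.gradient_eq_zero_of_notMem hx
    rw [← inner_gradient_left, this]
    simp

theorem EuclideanSpace.inner_gradient_eq_sum (f : EuclideanSpace ℝ (Fin N) → ℝ)
    (x y : EuclideanSpace ℝ (Fin N)) :
    inner ℝ y (gradient f x) = ∑ i, y i * fderiv ℝ f x (EuclideanSpace.single i 1) := by
  have h : y = ∑ i, y i • EuclideanSpace.single i (1 : ℝ) := by
    ext j; simp [Finset.sum_apply, Pi.single_apply]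
  rw [inner_gradient_right]
  conv_lhs => rw [h]
  simp [map_sum]

/-- Integration by parts for the radial vector fields `c (s - ‖x - q‖²) (x - q)`. -/
theorem TestFunction.integral_radial (φ : 𝓓(Ω, ℝ)) {c c' : ℝ → ℝ} (hc : ContDiff ℝ 1 c)
    (hc' : ∀ t, HasDerivAt c (c' t) t) (q : EuclideanSpace ℝ (Fin N)) (s : ℝ) :
    ∫ x in (Ω : Set (EuclideanSpace ℝ (Fin N))),
        c (s - ‖x - q‖ ^ 2) * inner ℝ (x - q) (gradient φ x)
      = - ∫ x in (Ω : Set (EuclideanSpace ℝ (Fin N))),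
        (N * c (s - ‖x - q‖ ^ 2) - 2 * c' (s - ‖x - q‖ ^ 2) * ‖x - q‖ ^ 2) * φ x := by
  have hψ : ContDiff ℝ 1 fun x : EuclideanSpace ℝ (Fin N) => s - ‖x - q‖ ^ 2 :=
    contDiff_const.sub ((contDiff_id.sub contDiff_const).norm_sq ℝ)
  have hcψ : ContDiff ℝ 1 fun x : EuclideanSpace ℝ (Fin N) => c (s - ‖x - q‖ ^ 2) := hc.comp hψ
  have hF : ∀ i, ContDiff ℝ 1 fun x : EuclideanSpace ℝ (Fin N) =>
      c (s - ‖x - q‖ ^ 2) * (x - q) i := fun i => by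
    refine hcψ.mul ?_
    exact (EuclideanSpace.proj (𝕜 := ℝ) i).contDiff.comp (contDiff_id.sub contDiff_const)
  -- The i-th term of the divergence of the radial field; summing over i turns the squares of the
  -- coordinates into ‖x - q‖².
  have hF' : ∀ i (x : EuclideanSpace ℝ (Fin N)), fderiv ℝ (fun x : EuclideanSpace ℝ (Fin N) =>
      c (s - ‖x - q‖ ^ 2) * (x - q) i) x (EuclideanSpace.single i 1)
      = c (s - ‖x - q‖ ^ 2) - 2 * c' (s - ‖x - q‖ ^ 2) * ((x - q) i) ^ 2 := fun i x => by
    have h1 : HasFDerivAt (fun x : EuclideanSpace ℝ (Fin N) => ‖x - q‖ ^ 2)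
        (2 • (innerSL ℝ (x - q))) x := by
      simpa using ((hasFDerivAt_id x).sub_const q).norm_sq
    have h2 := (hc' (s - ‖x - q‖ ^ 2)).comp_hasFDerivAt x (h1.const_sub s)
    have h3 : HasFDerivAt (fun x : EuclideanSpace ℝ (Fin N) => (x - q) i)
        (EuclideanSpace.proj (𝕜 := ℝ) i : EuclideanSpace ℝ (Fin N) →L[ℝ] ℝ) x :=
      (EuclideanSpace.proj (𝕜 := ℝ) i).hasFDerivAt.comp x
        (f := fun x => x - q) ((hasFDerivAt_id x).sub_const q)
    have h4 := (h2.mul h3).fderiv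
    simp only [Function.comp_def] at h4
    rw [show (fun x : EuclideanSpace ℝ (Fin N) => c (s - ‖x - q‖ ^ 2) * (x - q) i)
      = (fun x : EuclideanSpace ℝ (Fin N) => c (s - ‖x - q‖ ^ 2)) * fun x => (x - q) i from rfl, h4]
    simp [EuclideanSpace.inner_single_right, PiLp.proj_apply]
    ring
  have hint1 : ∀ i, IntegrableOn (fun x => c (s - ‖x - q‖ ^ 2) * (x - q) i *
      fderiv ℝ φ x (EuclideanSpace.single i 1)) (Ω : Set (EuclideanSpace ℝ (Fin N))) := fun i => by
    refine Integrable.integrableOn ?_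
    exact ((hF i).continuous.mul (φ.continuous_fderiv.clm_apply
      continuous_const)).integrable_of_hasCompactSupport
      (φ.hasCompactSupport.fderiv_apply ℝ _).mul_left
  have hint2 : ∀ i, IntegrableOn (fun x => fderiv ℝ (fun x : EuclideanSpace ℝ (Fin N) =>
      c (s - ‖x - q‖ ^ 2) * (x - q) i) x (EuclideanSpace.single i 1) * φ x)
      (Ω : Set (EuclideanSpace ℝ (Fin N))) := fun i => by
    refine Integrable.integrableOn ?_
    exact ((((hF i).continuous_fderiv (by simp)).clm_apply continuous_const).mul
      φ.continuous).integrable_of_hasCompactSupport φ.hasCompactSupport.mul_left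
  calc _ = ∫ x in (Ω : Set (EuclideanSpace ℝ (Fin N))), ∑ i, c (s - ‖x - q‖ ^ 2) * (x - q) i *
        fderiv ℝ φ x (EuclideanSpace.single i 1) := by
        congr with x
        rw [EuclideanSpace.inner_gradient_eq_sum, Finset.mul_sum]
        simp only [mul_assoc]
    _ = ∑ i, -∫ x in (Ω : Set (EuclideanSpace ℝ (Fin N))),
        fderiv ℝ (fun x : EuclideanSpace ℝ (Fin N) =>
          c (s - ‖x - q‖ ^ 2) * (x - q) i) x (EuclideanSpace.single i 1) * φ x := by
        rw [integral_finsetSum _ fun i _ => hint1 i]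
        exact Finset.sum_congr rfl fun i _ => φ.integral_mul_fderiv (hF i) _
    _ = _ := by
        rw [Finset.sum_neg_distrib, ← integral_finsetSum _ fun i _ => hint2 i]
        congr 2 with x
        simp only [hF']
        rw [← Finset.sum_mul, Finset.sum_sub_distrib, ← Finset.mul_sum, EuclideanSpace.norm_sq_eq]
        simp

/-- The Poincaré inequality for test functions. -/
theorem TestFunction.poincare (hN : 1 ≤ N) {R : ℝ} (hR : ∀ x ∈ Ω, ‖x‖ ≤ R) (φ : 𝓓(Ω, ℝ)) :
    ∫ x in (Ω : Set (EuclideanSpace ℝ (Fin N))), φ x ^ 2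
      ≤ 4 * R ^ 2 * ∫ x in (Ω : Set (EuclideanSpace ℝ (Fin N))), ‖gradient φ x‖ ^ 2 := by
  -- The divergence identity for the field x, tested with φ², reads N ∫ φ² = -∫ 2 φ x·∇φ.
  let φ2 : 𝓓(Ω, ℝ) := ⟨fun x => φ x * φ x, φ.contDiff.mul φ.contDiff,
    φ.hasCompactSupport.mul_left, (tsupport_mul_subset_left).trans φ.tsupport_subset⟩
  have hφ2 : ∀ x, φ2 x = φ x ^ 2 := fun x => (sq (φ x)).symm
  have hg : ∀ x, gradient φ2 x = (2 * φ x) • gradient φ x := fun x => by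
    refine HasGradientAt.gradient ?_
    have := (φ.differentiable x).hasFDerivAt
    rw [hasGradientAt_iff_hasFDerivAt]
    convert! this.mul this using 1
    ext v
    simp
    ring
  have key := φ2.integral_radial (c := fun _ => 1) (c' := fun _ => 0) contDiff_const
    (fun t => hasDerivAt_const t 1) 0 0
  have i1 : IntegrableOn (fun x => φ x ^ 2) (Ω : Set (EuclideanSpace ℝ (Fin N))) :=
    (φ.memLp 2).integrable_sq
  have i2 : IntegrableOn (fun x => ‖gradient φ x‖ ^ 2) (Ω : Set (EuclideanSpace ℝ (Fin N))) :=
    (φ.memLp_gradient 2).norm.integrable_sq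
  simp only [one_mul, sub_zero, mul_zero, zero_mul, mul_one, hφ2, hg, inner_smul_right] at key
  rw [integral_const_mul] at key
  have hle : - ∫ x in (Ω : Set (EuclideanSpace ℝ (Fin N))), 2 * φ x * inner ℝ x (gradient φ x)
      ≤ ∫ x in (Ω : Set (EuclideanSpace ℝ (Fin N))),
        ((1 / 2) * φ x ^ 2 + 2 * R ^ 2 * ‖gradient φ x‖ ^ 2) := by
    rw [← integral_neg]
    refine setIntegral_mono_on ?_ ((i1.const_mul _).add (i2.const_mul _)) Ω.2.measurableSet ?_
    · refine Integrable.integrableOn (Continuous.integrable_of_hasCompactSupport ?_ ?_)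
      · exact ((continuous_const.mul φ.continuous).mul
          (continuous_id.inner φ.continuous_gradient)).neg
      · refine HasCompactSupport.neg (f := fun x => 2 * φ x * inner ℝ x (gradient φ x)) ?_
        exact (φ.hasCompactSupport.mul_left (f := fun _ => (2 : ℝ))).mul_right
    · intro x hx
      have h1 := abs_real_inner_le_norm x (gradient φ x)
      have h2 : ‖x‖ * ‖gradient φ x‖ ≤ R * ‖gradient φ x‖ :=
        mul_le_mul_of_nonneg_right (hR x hx) (norm_nonneg _)
      have h3 : |φ x * inner ℝ x (gradient φ x)| ≤ |φ x| * (R * ‖gradient φ x‖) := by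
        rw [abs_mul]
        exact mul_le_mul_of_nonneg_left (h1.trans h2) (abs_nonneg _)
      have h4 := neg_abs_le (φ x * inner ℝ x (gradient φ x))
      -- Young's inequality 2ab ≤ a²/2 + 2b² with a = |φ| and b = R‖∇φ‖. The term φ²/2 is later
      -- absorbed on the left, using N ≥ 1.
      nlinarith [sq_nonneg (|φ x| - 2 * (R * ‖gradient φ x‖)), sq_abs (φ x)]
  rw [integral_add (i1.const_mul _) (i2.const_mul _), integral_const_mul, integral_const_mul] at hle
  have hN' : (1 : ℝ) ≤ N := by exact_mod_cast hN
  have h0 : 0 ≤ ∫ x in (Ω : Set (EuclideanSpace ℝ (Fin N))), φ x ^ 2 :=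
    integral_nonneg fun x => sq_nonneg _
  nlinarith

end TestFunctions

/-! ### W₀^{1,2}(Ω) as a closed space of pairs (u, ∇u), and the Dirichlet problem -/

section SobolevPairs

variable {N : ℕ}

/-- Pairs of a square-integrable function and a square-integrable vector field on `Ω`. -/
abbrev JetSpace (Ω : Opens (EuclideanSpace ℝ (Fin N))) : Type :=
  WithLp 2 (Lp ℝ 2 (volume.restrict (Ω : Set (EuclideanSpace ℝ (Fin N)))) ×
    Lp (EuclideanSpace ℝ (Fin N)) 2 (volume.restrict (Ω : Set (EuclideanSpace ℝ (Fin N)))))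

/-- The pair `(φ, ∇φ)` of a test function. -/
noncomputable def testJet (Ω : Opens (EuclideanSpace ℝ (Fin N))) : 𝓓(Ω, ℝ) →ₗ[ℝ] JetSpace Ω where
  toFun φ := WithLp.toLp 2 ((φ.memLp 2).toLp φ, (φ.memLp_gradient 2).toLp (gradient φ))
  map_add' φ ψ := by
    rw [← WithLp.toLp_add, Prod.mk_add_mk, ← MemLp.toLp_add, ← MemLp.toLp_add]
    congr 2
    refine MemLp.toLp_congr _ _ (Eventually.of_forall fun x => ?_)
    exact gradient_add_apply (φ.differentiable x) (ψ.differentiable x)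
  map_smul' c φ := by
    rw [RingHom.id_apply, ← WithLp.toLp_smul, Prod.smul_mk, ← MemLp.toLp_const_smul,
      ← MemLp.toLp_const_smul]
    congr 2
    refine MemLp.toLp_congr _ _ (Eventually.of_forall fun x => ?_)
    exact gradient_const_smul_apply (φ.differentiable x) c

/-- The closure of the pairs `(φ, ∇φ)`: the space `W₀^{1,2}(Ω)`, as a space of pairs `(u, ∇u)`. -/
noncomputable def sobolevW0 (Ω : Opens (EuclideanSpace ℝ (Fin N))) : Submodule ℝ (JetSpace Ω) :=
  (LinearMap.range (testJet Ω)).topologicalClosure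

variable {Ω : Opens (EuclideanSpace ℝ (Fin N))}

theorem testJet_mem (φ : 𝓓(Ω, ℝ)) : testJet Ω φ ∈ sobolevW0 Ω :=
  Submodule.le_topologicalClosure _ ⟨φ, rfl⟩

theorem coeFn_testJet_fst (φ : 𝓓(Ω, ℝ)) :
    (testJet Ω φ).fst =ᵐ[volume.restrict (Ω : Set (EuclideanSpace ℝ (Fin N)))] φ :=
  (φ.memLp 2).coeFn_toLp

theorem coeFn_testJet_snd (φ : 𝓓(Ω, ℝ)) :
    (testJet Ω φ).snd =ᵐ[volume.restrict (Ω : Set (EuclideanSpace ℝ (Fin N)))] gradient φ :=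
  (φ.memLp_gradient 2).coeFn_toLp

theorem exists_tendsto_testJet {p : JetSpace Ω} (hp : p ∈ sobolevW0 Ω) :
    ∃ φ : ℕ → 𝓓(Ω, ℝ), Tendsto (fun k => testJet Ω (φ k)) atTop (𝓝 p) := by
  obtain ⟨x, hx, hxp⟩ := mem_closure_iff_seq_limit.1 hp
  choose φ hφ using hx
  exact ⟨φ, by simpa only [hφ] using hxp⟩

theorem JetSpace.continuous_fst : Continuous fun p : JetSpace Ω => p.fst :=
  (WithLp.fstL 2 ℝ _ _).continuous

theorem JetSpace.continuous_snd : Continuous fun p : JetSpace Ω => p.snd :=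
  (WithLp.sndL 2 ℝ _ _).continuous

theorem sobolevW0_induction {P : JetSpace Ω → Prop} (hP : IsClosed {p | P p})
    (h : ∀ φ, P (testJet Ω φ)) {p : JetSpace Ω} (hp : p ∈ sobolevW0 Ω) : P p :=
  closure_minimal (s := Set.range (testJet Ω)) (t := {p | P p})
    (by rintro _ ⟨φ, rfl⟩; exact h φ) hP hp

theorem inner_testJet_fst (g : Lp ℝ 2 (volume.restrict (Ω : Set (EuclideanSpace ℝ (Fin N)))))
    (φ : 𝓓(Ω, ℝ)) :
    inner ℝ g (testJet Ω φ).fst = ∫ x in (Ω : Set (EuclideanSpace ℝ (Fin N))), g x * φ x := by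
  rw [L2.inner_def]
  refine integral_congr_ae ?_
  filter_upwards [coeFn_testJet_fst φ] with x hx
  simp [hx, mul_comm]

theorem inner_testJet_snd (g : Lp (EuclideanSpace ℝ (Fin N)) 2
      (volume.restrict (Ω : Set (EuclideanSpace ℝ (Fin N))))) (φ : 𝓓(Ω, ℝ)) :
    inner ℝ g (testJet Ω φ).snd
      = ∫ x in (Ω : Set (EuclideanSpace ℝ (Fin N))), inner ℝ (g x) (gradient φ x) := by
  rw [L2.inner_def]
  refine integral_congr_ae ?_
  filter_upwards [coeFn_testJet_snd φ] with x hx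
  simp [hx]

theorem norm_sq_testJet_snd (φ : 𝓓(Ω, ℝ)) : ‖(testJet Ω φ).snd‖ ^ 2
    = ∫ x in (Ω : Set (EuclideanSpace ℝ (Fin N))), ‖gradient φ x‖ ^ 2 := by
  rw [← real_inner_self_eq_norm_sq, inner_testJet_snd]
  refine integral_congr_ae ?_
  filter_upwards [coeFn_testJet_snd φ] with x hx
  simp [hx]

theorem norm_sq_testJet_fst (φ : 𝓓(Ω, ℝ)) : ‖(testJet Ω φ).fst‖ ^ 2
    = ∫ x in (Ω : Set (EuclideanSpace ℝ (Fin N))), φ x ^ 2 := by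
  rw [← real_inner_self_eq_norm_sq, inner_testJet_fst]
  refine integral_congr_ae ?_
  filter_upwards [coeFn_testJet_fst φ] with x hx
  simp [hx, sq]

/-- The Poincaré inequality on `W₀^{1,2}(Ω)`. -/
theorem poincare_sobolevW0 (hN : 1 ≤ N) {R : ℝ} (hR : ∀ x ∈ Ω, ‖x‖ ≤ R) {p : JetSpace Ω}
    (hp : p ∈ sobolevW0 Ω) : ‖p.fst‖ ^ 2 ≤ 4 * R ^ 2 * ‖p.snd‖ ^ 2 := by
  refine sobolevW0_induction (P := fun p => ‖p.fst‖ ^ 2 ≤ 4 * R ^ 2 * ‖p.snd‖ ^ 2) ?_ ?_ hp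
  · exact isClosed_le (JetSpace.continuous_fst.norm.pow 2)
      (continuous_const.mul (JetSpace.continuous_snd.norm.pow 2))
  · intro φ
    rw [norm_sq_testJet_fst, norm_sq_testJet_snd]
    exact φ.poincare hN hR

/-- Weak solutions in `W₀^{1,2}(Ω)` are unique. -/
theorem eq_of_weak_equation (hN : 1 ≤ N) (hΩ : Bornology.IsBounded (Ω : Set (EuclideanSpace ℝ (Fin N))))
    {p p' : JetSpace Ω} (hp : p ∈ sobolevW0 Ω) (hp' : p' ∈ sobolevW0 Ω)
    (h : ∀ φ, inner ℝ p.snd (testJet Ω φ).snd = inner ℝ p'.snd (testJet Ω φ).snd) : p = p' := by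
  obtain ⟨R, hR⟩ := isBounded_iff_forall_norm_le.1 hΩ
  have hd : p - p' ∈ sobolevW0 Ω := Submodule.sub_mem _ hp hp'
  -- The gradient of the difference is orthogonal to every test gradient, hence by density to
  -- itself.
  have h0 : inner ℝ (p - p').snd (p - p').snd = 0 := by
    refine sobolevW0_induction (P := fun r => inner ℝ (p - p').snd r.snd = 0) ?_ ?_ hd
    · exact isClosed_eq (continuous_const.inner JetSpace.continuous_snd) continuous_const
    · intro φ
      rw [WithLp.sub_snd, inner_sub_left, h, sub_self]
  have h1 : (p - p').snd = 0 := inner_self_eq_zero.1 h0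
  have h2 := poincare_sobolevW0 hN hR hd
  have h3 : (p - p').fst = 0 := by
    rw [h1] at h2
    have : ‖(p - p').fst‖ ^ 2 ≤ 0 := by simpa using h2
    exact norm_eq_zero.1 (pow_eq_zero_iff (two_ne_zero)|>.1 (le_antisymm this (sq_nonneg _)))
  refine sub_eq_zero.1 ((WithLp.ofLp_injective 2) (Prod.ext h3 h1))

/-- The solution operator of the Dirichlet problem `-Δ u = g`, `u ∈ W₀^{1,2}(Ω)`. -/
theorem exists_solution_operator (hN : 1 ≤ N)
    (hΩ : Bornology.IsBounded (Ω : Set (EuclideanSpace ℝ (Fin N)))) :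
    ∃ S : Lp ℝ 2 (volume.restrict (Ω : Set (EuclideanSpace ℝ (Fin N)))) →L[ℝ] JetSpace Ω,
      (∀ g, S g ∈ sobolevW0 Ω) ∧
      ∀ g φ, inner ℝ (S g).snd (testJet Ω φ).snd = inner ℝ g (testJet Ω φ).fst := by
  obtain ⟨R, hR⟩ := isBounded_iff_forall_norm_le.1 hΩ
  have : CompleteSpace (sobolevW0 Ω) :=
    (Submodule.isClosed_topologicalClosure _).completeSpace_coe
  let D : sobolevW0 Ω →L[ℝ] Lp (EuclideanSpace ℝ (Fin N)) 2
    (volume.restrict (Ω : Set (EuclideanSpace ℝ (Fin N)))) :=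
    (WithLp.sndL 2 ℝ _ _).comp (sobolevW0 Ω).subtypeL
  let B : sobolevW0 Ω →L[ℝ] sobolevW0 Ω →L[ℝ] ℝ := (innerSL ℝ).bilinearComp D D
  have hB : ∀ p p', B p p' = inner ℝ (p : JetSpace Ω).snd (p' : JetSpace Ω).snd := fun p p' => rfl
  have hco : IsCoercive B := by
    -- By Poincaré, ‖u‖² + ‖∇u‖² ≤ (4R² + 1)‖∇u‖², so the Dirichlet form is coercive and Lax–Milgram
    -- applies.
    refine ⟨(4 * R ^ 2 + 1)⁻¹, by positivity, fun p => ?_⟩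
    have h1 := poincare_sobolevW0 hN hR p.2
    have h2 : ‖p‖ * ‖p‖ = ‖(p : JetSpace Ω).fst‖ ^ 2 + ‖(p : JetSpace Ω).snd‖ ^ 2 := by
      rw [← WithLp.prod_norm_sq_eq_of_L2, ← sq, Submodule.coe_norm]
    rw [hB, real_inner_self_eq_norm_sq, mul_assoc, h2, inv_mul_le_iff₀ (by positivity)]
    linarith
  let e := hco.continuousLinearEquivOfBilin
  -- The adjoint of (u, ∇u) ↦ u represents the functional w ↦ ⟨g, w⟩ inside W₀^{1,2}(Ω).
  let ι : Lp ℝ 2 (volume.restrict (Ω : Set (EuclideanSpace ℝ (Fin N)))) →L[ℝ] sobolevW0 Ω :=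
    ((WithLp.fstL 2 ℝ _ _).comp (sobolevW0 Ω).subtypeL).adjoint
  refine ⟨(sobolevW0 Ω).subtypeL.comp (e.symm.toContinuousLinearMap.comp ι), fun g => ?_,
    fun g φ => ?_⟩
  · exact (e.symm (ι g)).2
  · let w : sobolevW0 Ω := ⟨testJet Ω φ, testJet_mem φ⟩
    calc _ = B (e.symm (ι g)) w := rfl
      _ = inner ℝ (e (e.symm (ι g))) w := (hco.continuousLinearEquivOfBilin_apply _ w).symm
      _ = inner ℝ (ι g) w := by rw [e.apply_symm_apply]
      _ = _ := ContinuousLinearMap.adjoint_inner_left _ _ _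

/-- Integration by parts against a fixed test function equates two continuous functionals of the
pair (u, ∇u), so it passes from test functions to the closure. -/
theorem isW012_of_mem_sobolevW0 {p : JetSpace Ω} (hp : p ∈ sobolevW0 Ω) :
    IsW012 Ω p.fst p.snd := by
  refine ⟨⟨Lp.memLp _, Lp.memLp _, ⟨?_, ?_, fun φ v => ?_⟩⟩, ?_⟩
  · exact locallyIntegrableOn_of_locallyIntegrable_restrict
      ((Lp.memLp p.fst).locallyIntegrable (by norm_num))
  · exact locallyIntegrableOn_of_locallyIntegrable_restrict
      ((Lp.memLp p.snd).locallyIntegrable (by norm_num))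
  · have hm1 : MemLp (fun x => fderiv ℝ φ x v) 2
        (volume.restrict (Ω : Set (EuclideanSpace ℝ (Fin N)))) := by
      simpa only [← inner_gradient_left] using (φ.memLp_gradient 2).inner_const v
    have hm2 : MemLp (fun x => φ x • v) 2
        (volume.restrict (Ω : Set (EuclideanSpace ℝ (Fin N)))) :=
      ((φ.continuous.smul continuous_const).memLp_of_hasCompactSupport
        φ.hasCompactSupport.smul_right).restrict _
    have h : inner ℝ (hm1.toLp) p.fst = - inner ℝ (hm2.toLp) p.snd := by
      refine sobolevW0_induction (P := fun p => inner ℝ (hm1.toLp) p.fst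
        = - inner ℝ (hm2.toLp) p.snd) ?_ ?_ hp
      · exact isClosed_eq (continuous_const.inner JetSpace.continuous_fst)
          (continuous_const.inner JetSpace.continuous_snd).neg
      · intro ψ
        rw [inner_testJet_fst, inner_testJet_snd]
        have := ψ.integral_mul_fderiv (φ.contDiff.of_le (by simp)) v
        rw [← neg_eq_iff_eq_neg] at this
        convert! this.symm using 1
        · refine integral_congr_ae ?_
          filter_upwards [hm1.coeFn_toLp] with x hx
          simp [hx]
        · congr 1
          refine integral_congr_ae ?_
          filter_upwards [hm2.coeFn_toLp] with x hx
          rw [hx, inner_smul_left, real_inner_comm, inner_gradient_left]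
          simp
    rw [L2.inner_def, L2.inner_def] at h
    convert! h using 1
    · refine integral_congr_ae ?_
      filter_upwards [hm1.coeFn_toLp] with x hx
      simp [hx]
    · congr 1
      refine integral_congr_ae ?_
      filter_upwards [hm2.coeFn_toLp] with x hx
      rw [hx, inner_smul_left, real_inner_comm]
      simp [mul_comm]
  · obtain ⟨φ, hφ⟩ := exists_tendsto_testJet hp
    refine ⟨φ, ?_, ?_⟩
    · have := (Lp.tendsto_Lp_iff_tendsto_eLpNorm' _ _).1
        ((JetSpace.continuous_fst.tendsto p).comp hφ)
      refine this.congr fun k => eLpNorm_congr_ae ?_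
      filter_upwards [coeFn_testJet_fst (φ k)] with x hx
      simp [hx]
    · have := (Lp.tendsto_Lp_iff_tendsto_eLpNorm' _ _).1
        ((JetSpace.continuous_snd.tendsto p).comp hφ)
      refine this.congr fun k => eLpNorm_congr_ae ?_
      filter_upwards [coeFn_testJet_snd (φ k)] with x hx
      simp [hx]

end SobolevPairs

/-! ### Derivative bounds for exp(-1/t) -/

section Glue

/-- The formula also covers t ≤ 0, where `expNegInvGlue` vanishes; at t = 0 the convention 0⁻¹ = 0
is harmless. -/
theorem hasDerivAt_expNegInvGlue (t : ℝ) :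
    HasDerivAt expNegInvGlue (t⁻¹ ^ 2 * expNegInvGlue t) t := by
  simpa using expNegInvGlue.hasDerivAt_polynomial_eval_inv_mul 1 t

theorem hasDerivAt_inv_sq_mul_expNegInvGlue (t : ℝ) :
    HasDerivAt (fun t => t⁻¹ ^ 2 * expNegInvGlue t)
      (t⁻¹ ^ 2 * (t⁻¹ ^ 2 - 2 * t⁻¹) * expNegInvGlue t) t := by
  convert! expNegInvGlue.hasDerivAt_polynomial_eval_inv_mul (Polynomial.X * Polynomial.X) t using 1
  · ext t
    simp [sq]
  · simp only [Polynomial.eval_mul, Polynomial.eval_pow, Polynomial.eval_sub, Polynomial.eval_X,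
      Polynomial.derivative_mul, Polynomial.derivative_X, Polynomial.eval_add, Polynomial.eval_one]
    ring

theorem contDiff_inv_sq_mul_expNegInvGlue {n : ℕ∞} :
    ContDiff ℝ n fun t => t⁻¹ ^ 2 * expNegInvGlue t := by
  convert! expNegInvGlue.contDiff_polynomial_eval_inv_mul (n := n)
    (Polynomial.X * Polynomial.X) using 2 with t
  rw [Polynomial.eval_mul, Polynomial.eval_X, sq]

theorem expNegInvGlue_le_one (t : ℝ) : expNegInvGlue t ≤ 1 := by
  rcases le_or_gt t 0 with h | h
  · simp [expNegInvGlue.zero_of_nonpos h]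
  · simp [expNegInvGlue, h.not_ge, h.le]

theorem inv_sq_mul_expNegInvGlue_nonneg (t : ℝ) : 0 ≤ t⁻¹ ^ 2 * expNegInvGlue t :=
  mul_nonneg (sq_nonneg _) (expNegInvGlue.nonneg t)

/-- With s = 1/t this is s² ≤ exp s, which follows from s ≤ exp(s/2). A slope η' in [0, 1] makes the
glue 1-Lipschitz and gives η'² ≤ η', both needed when it replaces the positive part in the
comparison principle. -/
theorem inv_sq_mul_expNegInvGlue_le_one (t : ℝ) : t⁻¹ ^ 2 * expNegInvGlue t ≤ 1 := by
  rcases le_or_gt t 0 with h | h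
  · simp [expNegInvGlue.zero_of_nonpos h]
  · have hs : 0 < t⁻¹ := inv_pos.2 h
    have h1 : t⁻¹ ≤ Real.exp (t⁻¹ / 2) := by
      have := Real.quadratic_le_exp_of_nonneg (x := t⁻¹ / 2) (by positivity)
      nlinarith [sq_nonneg (t⁻¹ / 2 - 1)]
    have h2 : t⁻¹ ^ 2 ≤ Real.exp t⁻¹ := by
      calc t⁻¹ ^ 2 ≤ Real.exp (t⁻¹ / 2) ^ 2 := by gcongr
        _ = Real.exp t⁻¹ := by rw [← Real.exp_nat_mul]; congr 1; push_cast; ring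
    simp only [expNegInvGlue, h.not_ge, if_false, Real.exp_neg]
    rw [← div_eq_mul_inv, div_le_one (Real.exp_pos _)]
    exact h2

theorem abs_expNegInvGlue_sub_le (s t : ℝ) : |expNegInvGlue s - expNegInvGlue t| ≤ |s - t| := by
  have h : LipschitzWith 1 expNegInvGlue := by
    refine lipschitzWith_of_nnnorm_deriv_le
      (fun t => (hasDerivAt_expNegInvGlue t).differentiableAt) fun t => ?_
    rw [(hasDerivAt_expNegInvGlue t).deriv, ← NNReal.coe_le_coe, coe_nnnorm, Real.norm_eq_abs,
      abs_of_nonneg (inv_sq_mul_expNegInvGlue_nonneg t)]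
    exact inv_sq_mul_expNegInvGlue_le_one t
  simpa [Real.dist_eq] using h.dist_le_mul s t

end Glue

/-! ### Comparison and maximum principles -/

section Comparison

variable {N : ℕ} {Ω : Opens (EuclideanSpace ℝ (Fin N))}

/-- A smooth version of the positive part of `φ - w` is a test function when `0 ≤ w` on `Ω`. -/
theorem TestFunction.exists_smooth_posPart_sub (φ : 𝓓(Ω, ℝ)) {w : EuclideanSpace ℝ (Fin N) → ℝ}
    (hw : ContDiff ℝ ∞ w) (hw0 : ∀ x ∈ Ω, 0 ≤ w x) :
    ∃ ψ : 𝓓(Ω, ℝ), (∀ x, 0 ≤ ψ x) ∧ (∀ x ∈ Ω, ψ x = expNegInvGlue (φ x - w x)) ∧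
      ∀ x ∈ Ω, gradient ψ x = ((φ x - w x)⁻¹ ^ 2 * expNegInvGlue (φ x - w x)) •
        (gradient φ x - gradient w x) := by
  classical
  let F : EuclideanSpace ℝ (Fin N) → ℝ := fun x => if x ∈ Ω then expNegInvGlue (φ x - w x) else 0
  -- Where φ vanishes in Ω, φ - w = -w ≤ 0 and the glue is zero. The cutoff outside Ω is needed
  -- because w may be negative there.
  have hsupp : tsupport F ⊆ tsupport φ := by
    refine closure_mono fun x hx => ?_
    rw [Function.mem_support] at hx ⊢
    contrapose! hx
    by_cases hxΩ : x ∈ Ω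
    · simp [F, hxΩ, hx, expNegInvGlue.zero_of_nonpos, hw0 x hxΩ]
    · simp [F, hxΩ]
  have hev : ∀ x ∈ Ω, F =ᶠ[𝓝 x] fun y => expNegInvGlue (φ y - w y) := fun x hx => by
    filter_upwards [Ω.2.mem_nhds hx] with y hy
    exact if_pos hy
  have hF : ContDiff ℝ ∞ F := by
    rw [contDiff_iff_contDiffAt]
    intro x
    by_cases hx : x ∈ tsupport φ
    · refine ContDiffAt.congr_of_eventuallyEq ?_ (hev x (φ.tsupport_subset hx))
      exact (expNegInvGlue.contDiff.comp (φ.contDiff.sub hw)).contDiffAt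
    · refine contDiffAt_const (c := (0 : ℝ)) |>.congr_of_eventuallyEq ?_
      filter_upwards [(isClosed_tsupport φ).isOpen_compl.mem_nhds hx] with y hy
      exact image_eq_zero_of_notMem_tsupport fun h => hy (hsupp h)
  refine ⟨⟨F, hF, φ.hasCompactSupport.of_isClosed_subset (isClosed_tsupport F) hsupp,
    hsupp.trans φ.tsupport_subset⟩, fun x => ?_, fun x hx => if_pos hx, fun x hx => ?_⟩
  · change 0 ≤ F x
    by_cases hx : x ∈ Ω
    · simp [F, hx, expNegInvGlue.nonneg]
    · simp [F, hx]
  · change gradient F x = _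
    rw [(hev x hx).gradient_eq]
    refine HasGradientAt.gradient ?_
    rw [hasGradientAt_iff_hasFDerivAt]
    have h1 := ((φ.differentiable x).hasFDerivAt).sub
      (((hw.differentiable (by simp)) x).hasFDerivAt)
    convert! (hasDerivAt_expNegInvGlue _).comp_hasFDerivAt x h1 using 1
    simp

/-- Comparison of a weak solution in `W₀^{1,2}(Ω)` with a smooth supersolution that is
nonnegative on `Ω`. -/
theorem ae_le_of_supersolution (hN : 1 ≤ N)
    (hΩ : Bornology.IsBounded (Ω : Set (EuclideanSpace ℝ (Fin N)))) {p : JetSpace Ω}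
    (hp : p ∈ sobolevW0 Ω) {g : Lp ℝ 2 (volume.restrict (Ω : Set (EuclideanSpace ℝ (Fin N))))}
    (hg : ∀ φ, inner ℝ p.snd (testJet Ω φ).snd = inner ℝ g (testJet Ω φ).fst)
    {w : EuclideanSpace ℝ (Fin N) → ℝ} (hw : ContDiff ℝ ∞ w) (hw0 : ∀ x ∈ Ω, 0 ≤ w x)
    (hwg : ∀ ψ : 𝓓(Ω, ℝ), (∀ x, 0 ≤ ψ x) →
      ∫ x in (Ω : Set (EuclideanSpace ℝ (Fin N))), g x * ψ x
        ≤ ∫ x in (Ω : Set (EuclideanSpace ℝ (Fin N))), inner ℝ (gradient w x) (gradient ψ x)) :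
    ∀ᵐ x ∂(volume.restrict (Ω : Set (EuclideanSpace ℝ (Fin N)))), p.fst x ≤ w x := by
  obtain ⟨R, hR⟩ := isBounded_iff_forall_norm_le.1 hΩ
  obtain ⟨φ, hφ⟩ := exists_tendsto_testJet hp
  choose ψ hψ0 hψ hψ' using fun k => (φ k).exists_smooth_posPart_sub hw hw0
  have hwc : Continuous (gradient w) :=
    (InnerProductSpace.toDual ℝ _).symm.continuous.comp (hw.continuous_fderiv (by simp))
  have hint : ∀ {V : EuclideanSpace ℝ (Fin N) → EuclideanSpace ℝ (Fin N)}, Continuous V →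
      ∀ χ : 𝓓(Ω, ℝ), IntegrableOn (fun x => inner ℝ (V x) (gradient χ x))
        (Ω : Set (EuclideanSpace ℝ (Fin N))) := fun hV χ => by
    refine ((hV.inner χ.continuous_gradient).integrable_of_hasCompactSupport ?_).integrableOn
    refine χ.hasCompactSupport_gradient.mono fun x hx => ?_
    rw [Function.mem_support] at hx ⊢
    contrapose! hx
    simp [hx]
  -- Since η'² ≤ η', ‖∇ψₖ‖² ≤ ⟨∇φₖ - ∇w, ∇ψₖ⟩. The equation for p and the supersolution property
  -- allow ∇w to be replaced by the gradient of p; Cauchy–Schwarz concludes.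
  have hgrad : ∀ k, ‖(testJet Ω (ψ k)).snd‖ ≤ ‖(testJet Ω (φ k)).snd - p.snd‖ := fun k => by
    have h1 : ‖(testJet Ω (ψ k)).snd‖ ^ 2 ≤ inner ℝ (testJet Ω (φ k)).snd (testJet Ω (ψ k)).snd
        - ∫ x in (Ω : Set (EuclideanSpace ℝ (Fin N))),
          inner ℝ (gradient w x) (gradient (ψ k) x) := by
      rw [norm_sq_testJet_snd, inner_testJet_snd]
      have h2 : ∫ x in (Ω : Set (EuclideanSpace ℝ (Fin N))),
          inner ℝ ((testJet Ω (φ k)).snd x) (gradient (ψ k) x)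
          = ∫ x in (Ω : Set (EuclideanSpace ℝ (Fin N))),
          inner ℝ (gradient (φ k) x) (gradient (ψ k) x) := by
        refine integral_congr_ae ?_
        filter_upwards [coeFn_testJet_snd (φ k)] with x hx
        rw [hx]
      rw [h2, ← integral_sub (hint (φ k).continuous_gradient (ψ k)) (hint hwc (ψ k))]
      refine setIntegral_mono_on ((ψ k).memLp_gradient 2).norm.integrable_sq
        ((hint (φ k).continuous_gradient (ψ k)).sub (hint hwc (ψ k))) Ω.2.measurableSet
        fun x hx => ?_
      rw [← inner_sub_left, hψ' k x hx, inner_smul_right, norm_smul, mul_pow,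
        real_inner_self_eq_norm_sq]
      have h3 := inv_sq_mul_expNegInvGlue_nonneg (φ k x - w x)
      have h4 := inv_sq_mul_expNegInvGlue_le_one (φ k x - w x)
      rw [Real.norm_eq_abs, sq_abs]
      refine mul_le_mul_of_nonneg_right ?_ (sq_nonneg _)
      nlinarith
    have h5 := hwg (ψ k) (hψ0 k)
    have h6 := hg (ψ k)
    rw [inner_testJet_fst] at h6
    have h7 := real_inner_le_norm ((testJet Ω (φ k)).snd - p.snd) (testJet Ω (ψ k)).snd
    rw [inner_sub_left] at h7
    by_contra! h8
    nlinarith [norm_nonneg ((testJet Ω (φ k)).snd - p.snd)]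
  have hfst : Tendsto (fun k => (testJet Ω (φ k)).fst - p.fst) atTop (𝓝 0) := by
    have := ((JetSpace.continuous_fst.tendsto p).comp hφ).sub_const p.fst
    simpa only [sub_self, Function.comp_def] using this
  have hsnd : Tendsto (fun k => (testJet Ω (φ k)).snd - p.snd) atTop (𝓝 0) := by
    have := ((JetSpace.continuous_snd.tendsto p).comp hφ).sub_const p.snd
    simpa only [sub_self, Function.comp_def] using this
  have hψfst : Tendsto (fun k => (testJet Ω (ψ k)).fst) atTop (𝓝 0) := by
    rw [tendsto_zero_iff_norm_tendsto_zero]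
    have h1 : ∀ k, ‖(testJet Ω (ψ k)).fst‖ ≤ 2 * |R| * ‖(testJet Ω (φ k)).snd - p.snd‖ := fun k => by
      refine le_trans ?_ (mul_le_mul_of_nonneg_left (hgrad k) (by positivity))
      refine abs_le_of_sq_le_sq' ?_ (by positivity) |>.2
      refine (poincare_sobolevW0 hN hR (testJet_mem (ψ k))).trans_eq ?_
      rw [mul_pow, mul_pow, sq_abs]; ring
    refine squeeze_zero (fun _ => norm_nonneg _) h1 ?_
    simpa using hsnd.norm.const_mul (2 * |R|)
  have hr : Tendsto (fun k => |(testJet Ω (ψ k)).fst| + |(testJet Ω (φ k)).fst - p.fst|) atTop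
      (𝓝 0) := by
    rw [tendsto_zero_iff_norm_tendsto_zero]
    refine squeeze_zero (fun _ => norm_nonneg _) (fun k => norm_add_le _ _) ?_
    simpa [norm_abs_eq_norm] using hψfst.norm.add hfst.norm
  -- The glue is 1-Lipschitz, so its value at p - w is at most ψₖ + |φₖ - p|, and both terms tend to
  -- 0 in L².
  have hle : ∀ k, eLpNorm (fun x => expNegInvGlue (p.fst x - w x)) 2
      (volume.restrict (Ω : Set (EuclideanSpace ℝ (Fin N))))
      ≤ ‖|(testJet Ω (ψ k)).fst| + |(testJet Ω (φ k)).fst - p.fst|‖ₑ := fun k => by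
    rw [Lp.enorm_def]
    refine eLpNorm_mono_ae ?_
    filter_upwards [Lp.coeFn_add |(testJet Ω (ψ k)).fst| |(testJet Ω (φ k)).fst - p.fst|,
      Lp.coeFn_abs (testJet Ω (ψ k)).fst, Lp.coeFn_abs ((testJet Ω (φ k)).fst - p.fst),
      Lp.coeFn_sub (testJet Ω (φ k)).fst p.fst, coeFn_testJet_fst (ψ k), coeFn_testJet_fst (φ k),
      ae_restrict_mem Ω.2.measurableSet] with x h1 h2 h3 h4 h5 h6 hx
    rw [h1, Pi.add_apply, h2, h3, h4, Pi.sub_apply, h5, h6, hψ k x hx]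
    have h7 := abs_expNegInvGlue_sub_le (p.fst x - w x) (φ k x - w x)
    have h8 : |p.fst x - w x - (φ k x - w x)| = |φ k x - p.fst x| := by
      rw [abs_sub_comm]; congr 1; ring
    rw [h8] at h7
    have h9 := abs_sub_abs_le_abs_sub (expNegInvGlue (p.fst x - w x))
      (expNegInvGlue (φ k x - w x))
    rw [Real.norm_eq_abs, Real.norm_eq_abs]
    refine le_trans ?_ (le_abs_self _)
    linarith
  have hzero : eLpNorm (fun x => expNegInvGlue (p.fst x - w x)) 2
      (volume.restrict (Ω : Set (EuclideanSpace ℝ (Fin N)))) = 0 := by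
    refine le_antisymm (ge_of_tendsto' (x := atTop) ?_ hle) zero_le
    simpa using hr.enorm
  rw [eLpNorm_eq_zero_iff ?_ (by norm_num)] at hzero
  · filter_upwards [hzero] with x hx
    have := expNegInvGlue.zero_iff_nonpos.1 hx
    linarith
  · exact (expNegInvGlue.contDiff (n := 0)).continuous.comp_aestronglyMeasurable
      ((Lp.aestronglyMeasurable _).sub hw.continuous.aestronglyMeasurable)

/-- The weak maximum principle in `W₀^{1,2}(Ω)`. -/
theorem fst_nonneg_of_weak_equation (hN : 1 ≤ N)
    (hΩ : Bornology.IsBounded (Ω : Set (EuclideanSpace ℝ (Fin N)))) {p : JetSpace Ω}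
    (hp : p ∈ sobolevW0 Ω) {g : Lp ℝ 2 (volume.restrict (Ω : Set (EuclideanSpace ℝ (Fin N))))}
    (hg : ∀ φ, inner ℝ p.snd (testJet Ω φ).snd = inner ℝ g (testJet Ω φ).fst) (hg0 : 0 ≤ g) :
    0 ≤ p.fst := by
  have h := ae_le_of_supersolution hN hΩ (Submodule.neg_mem _ hp) (g := -g) (w := fun _ => 0)
    (fun φ => by rw [WithLp.neg_snd, inner_neg_left, inner_neg_left, hg]) contDiff_const
    (fun _ _ => le_rfl) (fun ψ hψ => by
      simp only [gradient_fun_const, inner_zero_left, integral_zero]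
      refine integral_nonpos_of_ae ?_
      filter_upwards [Lp.coeFn_neg g, (Lp.coeFn_nonneg g).2 hg0] with x h1 h2
      rw [h1, Pi.neg_apply, neg_mul]
      exact neg_nonpos.2 (mul_nonneg h2 (hψ x)))
  rw [← Lp.coeFn_nonneg]
  filter_upwards [h, Lp.coeFn_neg p.fst] with x h1 h2
  rw [WithLp.neg_fst, h2] at h1
  exact neg_nonpos.1 h1

/-- The uniform bound for weak solutions with right-hand side bounded above. -/
theorem fst_le_of_weak_equation (hN : 1 ≤ N) {R : ℝ} (hR : ∀ x ∈ Ω, ‖x‖ ≤ R) {p : JetSpace Ω}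
    (hp : p ∈ sobolevW0 Ω) {g : Lp ℝ 2 (volume.restrict (Ω : Set (EuclideanSpace ℝ (Fin N))))}
    (hg : ∀ φ, inner ℝ p.snd (testJet Ω φ).snd = inner ℝ g (testJet Ω φ).fst)
    {c : ℝ} (hc : 0 ≤ c)
    (hgc : ∀ᵐ x ∂(volume.restrict (Ω : Set (EuclideanSpace ℝ (Fin N)))), g x ≤ c) :
    ∀ᵐ x ∂(volume.restrict (Ω : Set (EuclideanSpace ℝ (Fin N)))), p.fst x ≤ c * R ^ 2 := by
  have hΩ : Bornology.IsBounded (Ω : Set (EuclideanSpace ℝ (Fin N))) :=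
    isBounded_iff_forall_norm_le.2 ⟨R, hR⟩
  have hw : ∀ x : EuclideanSpace ℝ (Fin N),
      gradient (fun x => c / 2 * (R ^ 2 - ‖x‖ ^ 2)) x = (-c) • x := fun x => by
    refine HasGradientAt.gradient ?_
    rw [hasGradientAt_iff_hasFDerivAt]
    convert! (((hasFDerivAt_id x).norm_sq.const_sub (R ^ 2)).const_mul (c / 2)) using 1
    ext v
    simp
    ring
  -- The paraboloid w = c(R² - ‖x‖²)/2 is nonnegative on Ω and has -Δw = Nc ≥ c.
  have h := ae_le_of_supersolution hN hΩ hp hg (w := fun x => c / 2 * (R ^ 2 - ‖x‖ ^ 2))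
    (contDiff_const.mul (contDiff_const.sub (contDiff_id.norm_sq ℝ)))
    (fun x hx => by
      have := hR x hx
      have h0 := norm_nonneg x
      have : ‖x‖ ^ 2 ≤ R ^ 2 := by gcongr
      exact mul_nonneg (by positivity) (by linarith)) (fun ψ hψ => by
      have key := ψ.integral_radial (c := fun _ => 1) (c' := fun _ => 0) contDiff_const
        (fun t => hasDerivAt_const t 1) 0 0
      simp only [one_mul, sub_zero, mul_zero, zero_mul, mul_one] at key
      simp only [hw, inner_smul_left, conj_trivial]
      rw [integral_const_mul, key, ← integral_neg, ← integral_const_mul]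
      refine integral_mono_ae ?_ ?_ ?_
      · exact (Lp.memLp g).integrable_mul (ψ.memLp 2)
      · exact (((memLp_one_iff_integrable.1 (ψ.memLp 1)).const_mul _).neg).const_mul _
      · filter_upwards [hgc] with x hx
        have hN' : (1 : ℝ) ≤ N := by exact_mod_cast hN
        have h1 : c * ψ x ≤ N * (c * ψ x) := le_mul_of_one_le_left (mul_nonneg hc (hψ x)) hN'
        have h2 := mul_le_mul_of_nonneg_right hx (hψ x)
        linarith)
  filter_upwards [h] with x hx
  nlinarith [sq_nonneg R, mul_nonneg hc (sq_nonneg ‖x‖), mul_nonneg hc (sq_nonneg R)]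

end Comparison

/-! ### A bump function with -Δv ≤ K v -/

section Bump

/-- Beyond s = (b + e)/a + 1 the quartic term dominates and the sum is nonpositive; below it,
dropping the quartic leaves an increasing function. With s = 1/(r² - ‖x - q‖²) this bounds -Δv / v
up to the edge of the support. -/
theorem exists_bound_neg_quartic {a b e : ℝ} (ha : 0 < a) (hb : 0 ≤ b) (he : 0 ≤ e) :
    ∃ K, 0 ≤ K ∧ ∀ s, 0 ≤ s → -a * s ^ 4 + b * s ^ 3 + e * s ^ 2 ≤ K := by
  have h0 : 0 ≤ (b + e) / a := by positivity
  refine ⟨b * ((b + e) / a + 1) ^ 3 + e * ((b + e) / a + 1) ^ 2, by positivity, fun s hs => ?_⟩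
  rcases le_total s ((b + e) / a + 1) with h | h
  · have h1 : b * s ^ 3 ≤ b * ((b + e) / a + 1) ^ 3 := by gcongr
    have h2 : e * s ^ 2 ≤ e * ((b + e) / a + 1) ^ 2 := by gcongr
    have h3 : 0 ≤ a * s ^ 4 := by positivity
    linarith
  · have h1 : b + e ≤ a * s := by
      have := mul_le_mul_of_nonneg_left h ha.le
      rw [mul_add, mul_div_cancel₀ _ ha.ne'] at this
      linarith
    have h2 : (b + e) * s ^ 3 ≤ a * s * s ^ 3 := by gcongr
    have hs1 : 1 ≤ s := by linarith
    have h3 : e * s ^ 2 ≤ e * s ^ 3 := by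
      gcongr
      norm_num
    have h4 : 0 ≤ b * ((b + e) / a + 1) ^ 3 + e * ((b + e) / a + 1) ^ 2 := by positivity
    linarith

/-- The function `exp (-1 / (r² - ‖x - q‖²))`, extended by zero, satisfies `-Δ v ≤ K v`. -/
theorem exists_bump_neg_laplacian_le {N : ℕ} {Ω : Opens (EuclideanSpace ℝ (Fin N))}
    {q : EuclideanSpace ℝ (Fin N)} (hq : q ∈ Ω) {δ : ℝ} (hδ : 0 < δ) :
    ∃ (v : 𝓓(Ω, ℝ)) (d : EuclideanSpace ℝ (Fin N) → ℝ) (K : ℝ), 0 ≤ K ∧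
      MemLp d 2 (volume.restrict (Ω : Set (EuclideanSpace ℝ (Fin N)))) ∧
      (∀ x, 0 ≤ v x) ∧ (∀ x, v x ≤ 1) ∧ 0 < v q ∧ (∀ x, d x ≤ K * v x) ∧
      (∀ x, x ∉ Metric.ball q δ → v x = 0) ∧
      ∀ φ : 𝓓(Ω, ℝ), ∫ x in (Ω : Set (EuclideanSpace ℝ (Fin N))),
          inner ℝ (gradient v x) (gradient φ x)
        = ∫ x in (Ω : Set (EuclideanSpace ℝ (Fin N))), d x * φ x := by
  obtain ⟨r₀, hr₀, hball⟩ := Metric.nhds_basis_closedBall.mem_iff.1 (Ω.2.mem_nhds hq)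
  set r := min r₀ δ with hr
  have hr0 : 0 < r := lt_min hr₀ hδ
  have hrΩ : Metric.closedBall q r ⊆ Ω :=
    (Metric.closedBall_subset_closedBall (min_le_left _ _)).trans hball
  -- With s = 1/(r² - ‖x - q‖²), -Δv / v = -4r² s⁴ + (8r² + 4) s³ + (2N - 8) s²; the term -8s² is
  -- discarded.
  obtain ⟨K, hK0, hK⟩ := exists_bound_neg_quartic (a := 4 * r ^ 2) (b := 8 * r ^ 2 + 4)
    (e := 2 * N) (by positivity) (by positivity) (by positivity)
  have hout : ∀ x, x ∉ Metric.ball q r → r ^ 2 - ‖x - q‖ ^ 2 ≤ 0 := fun x hx => by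
    rw [Metric.mem_ball, dist_eq_norm, not_lt] at hx
    have : r ^ 2 ≤ ‖x - q‖ ^ 2 := by gcongr
    linarith
  have hψ : ContDiff ℝ ∞ fun x : EuclideanSpace ℝ (Fin N) => r ^ 2 - ‖x - q‖ ^ 2 :=
    contDiff_const.sub ((contDiff_id.sub contDiff_const).norm_sq ℝ)
  have hv : ContDiff ℝ ∞ fun x : EuclideanSpace ℝ (Fin N) =>
      expNegInvGlue (r ^ 2 - ‖x - q‖ ^ 2) := expNegInvGlue.contDiff.comp hψ
  have hvs : tsupport (fun x : EuclideanSpace ℝ (Fin N) =>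
      expNegInvGlue (r ^ 2 - ‖x - q‖ ^ 2)) ⊆ Metric.closedBall q r := by
    refine closure_minimal (fun x hx => ?_) Metric.isClosed_closedBall
    by_contra h
    exact hx (expNegInvGlue.zero_of_nonpos
      (hout x fun h' => h (Metric.ball_subset_closedBall h')))
  have hh' : ∀ t, HasDerivAt (fun t => t⁻¹ ^ 2 * expNegInvGlue t) _ t :=
    hasDerivAt_inv_sq_mul_expNegInvGlue
  -- Continuity at t = 0 comes for free: this is the derivative of a C¹ function.
  have hc' : Continuous fun t : ℝ => t⁻¹ ^ 2 * (t⁻¹ ^ 2 - 2 * t⁻¹) * expNegInvGlue t := by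
    have := (contDiff_inv_sq_mul_expNegInvGlue (n := 1)).continuous_deriv (by simp)
    rwa [funext fun t => (hh' t).deriv] at this
  let v : 𝓓(Ω, ℝ) := ⟨_, hv, (isCompact_closedBall q r).of_isClosed_subset
    (isClosed_tsupport _) hvs, hvs.trans hrΩ⟩
  have hvx : ∀ x, v x = expNegInvGlue (r ^ 2 - ‖x - q‖ ^ 2) := fun _ => rfl
  let h1 : ℝ → ℝ := fun t => t⁻¹ ^ 2 * expNegInvGlue t
  let h2 : ℝ → ℝ := fun t => t⁻¹ ^ 2 * (t⁻¹ ^ 2 - 2 * t⁻¹) * expNegInvGlue t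
  let d : EuclideanSpace ℝ (Fin N) → ℝ := fun x =>
    2 * (N * h1 (r ^ 2 - ‖x - q‖ ^ 2) - 2 * h2 (r ^ 2 - ‖x - q‖ ^ 2) * ‖x - q‖ ^ 2)
  have hd0 : ∀ x, x ∉ Metric.ball q r → d x = 0 := fun x hx => by
    simp [d, h1, h2, expNegInvGlue.zero_of_nonpos (hout x hx)]
  refine ⟨v, d, K, hK0, ?_, fun x => ?_, fun x => ?_, ?_, fun x => ?_, fun x hx => ?_, fun φ => ?_⟩
  · have hdc : Continuous d := by
      have e1 : Continuous h1 := (contDiff_inv_sq_mul_expNegInvGlue (n := 0)).continuous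
      have e2 : Continuous h2 := hc'
      fun_prop
    refine (hdc.memLp_of_hasCompactSupport ?_).restrict _
    refine HasCompactSupport.of_support_subset_isCompact (isCompact_closedBall q r) fun x hx => ?_
    by_contra h
    exact hx (hd0 x fun h' => h (Metric.ball_subset_closedBall h'))
  · exact expNegInvGlue.nonneg _
  · exact expNegInvGlue_le_one _
  · rw [hvx]
    refine expNegInvGlue.pos_of_pos ?_
    simpa using pow_pos hr0 2
  · by_cases hx : x ∈ Metric.ball q r
    · have hpos : 0 < r ^ 2 - ‖x - q‖ ^ 2 := by
        rw [Metric.mem_ball, dist_eq_norm] at hx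
        have : ‖x - q‖ ^ 2 < r ^ 2 := by gcongr
        linarith
      have hx2 : ‖x - q‖ ^ 2 = r ^ 2 - (r ^ 2 - ‖x - q‖ ^ 2) := by ring
      rw [hvx]
      simp only [d, h1, h2]
      generalize r ^ 2 - ‖x - q‖ ^ 2 = t at hpos hx2
      rw [hx2]
      have hs := hK t⁻¹ (inv_nonneg.2 hpos.le)
      have hst : t⁻¹ * t = 1 := inv_mul_cancel₀ hpos.ne'
      calc _ = (-(4 * r ^ 2) * t⁻¹ ^ 4 + 8 * r ^ 2 * t⁻¹ ^ 3 + 4 * (t⁻¹ * t) * t⁻¹ ^ 3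
            - 8 * (t⁻¹ * t) * t⁻¹ ^ 2 + 2 * N * t⁻¹ ^ 2) * expNegInvGlue t := by ring
        _ ≤ K * expNegInvGlue t := by
          refine mul_le_mul_of_nonneg_right ?_ (expNegInvGlue.nonneg t)
          rw [hst]
          nlinarith [sq_nonneg t⁻¹]
    · rw [hd0 x hx]
      exact mul_nonneg hK0 (expNegInvGlue.nonneg _)
  · rw [hvx]
    exact expNegInvGlue.zero_of_nonpos
      (hout x fun h => hx (Metric.ball_subset_ball (min_le_right _ _) h))
  · have hgrad : ∀ x, gradient v x = (-2 * h1 (r ^ 2 - ‖x - q‖ ^ 2)) • (x - q) := fun x => by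
      refine HasGradientAt.gradient ?_
      rw [hasGradientAt_iff_hasFDerivAt]
      have e1 : HasFDerivAt (fun x : EuclideanSpace ℝ (Fin N) => ‖x - q‖ ^ 2)
          (2 • (innerSL ℝ (x - q))) x := by
        simpa using ((hasFDerivAt_id x).sub_const q).norm_sq
      convert! (hasDerivAt_expNegInvGlue _).comp_hasFDerivAt x (e1.const_sub (r ^ 2)) using 1
      ext y
      simp [h1]
      ring
    have key := φ.integral_radial (c := h1) (c' := h2) contDiff_inv_sq_mul_expNegInvGlue hh' q
      (r ^ 2)
    simp only [hgrad, inner_smul_left, conj_trivial, d, mul_assoc] at key ⊢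
    rw [integral_const_mul, integral_const_mul, key]
    ring

end Bump

/-! ### Measurability of the nonlinearity -/

section Nonlinearity

variable {ι : Type*} [Finite ι]

/-- Continuity along nondecreasing sequences of nonnegative vectors implies Borel measurability on
the nonnegative orthant. -/
theorem measurable_comp_sup_zero {f : (ι → ℝ) → ℝ}
    (hf : ∀ (z : ℕ → ι → ℝ) (z' : ι → ℝ), (∀ k, 0 ≤ z k) → Monotone z →
      Tendsto z atTop (𝓝 z') → Tendsto (fun k => f (z k)) atTop (𝓝 (f z'))) :
    Measurable fun z => f (z ⊔ 0) := by
  -- Dyadic truncations from below: they increase to z ⊔ 0, so the sequential hypothesis applies,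
  -- and each factors through the countable discrete space ι → ℕ, where every function is
  -- measurable.
  let a : ℕ → (ι → ℝ) → ι → ℝ := fun k z j => (⌊(z ⊔ 0) j * 2 ^ k⌋₊ : ℝ) / 2 ^ k
  have hpos : ∀ (z : ι → ℝ) j, 0 ≤ (z ⊔ 0) j := fun z j => le_sup_right
  have hmono : ∀ z, Monotone fun k => a k z := fun z => by
    refine monotone_nat_of_le_succ fun k j => ?_
    simp only [a]
    rw [div_le_div_iff₀ (by positivity) (by positivity)]
    have h1 : 2 * ⌊(z ⊔ 0) j * 2 ^ k⌋₊ ≤ ⌊(z ⊔ 0) j * 2 ^ (k + 1)⌋₊ := by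
      refine Nat.le_floor ?_
      have := Nat.floor_le (mul_nonneg (hpos z j) (by positivity : (0 : ℝ) ≤ 2 ^ k))
      push_cast
      rw [pow_succ]
      linarith
    have h2 : (2 : ℝ) * ⌊(z ⊔ 0) j * 2 ^ k⌋₊ ≤ ⌊(z ⊔ 0) j * 2 ^ (k + 1)⌋₊ := by exact_mod_cast h1
    calc (⌊(z ⊔ 0) j * 2 ^ k⌋₊ : ℝ) * 2 ^ (k + 1) = 2 * ⌊(z ⊔ 0) j * 2 ^ k⌋₊ * 2 ^ k := by
          rw [pow_succ (2 : ℝ) k]; ring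
      _ ≤ _ := mul_le_mul_of_nonneg_right h2 (by positivity)
  have hlim : ∀ z, Tendsto (fun k => a k z) atTop (𝓝 (z ⊔ 0)) := fun z => by
    rw [tendsto_pi_nhds]
    intro j
    exact (tendsto_nat_floor_mul_div_atTop (hpos z j)).comp
      (tendsto_pow_atTop_atTop_of_one_lt one_lt_two)
  refine measurable_of_tendsto_metrizable (f := fun k z => f (a k z)) (fun k => ?_) ?_
  · have h1 : Measurable fun (m : ι → ℕ) => f fun j => (m j : ℝ) / 2 ^ k := Measurable.of_discrete
    refine h1.comp (measurable_pi_lambda _ fun j => ?_)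
    exact Nat.measurable_floor.comp
      (((measurable_pi_apply j).sup measurable_const).mul_const _)
  · rw [tendsto_pi_nhds]
    exact fun z => hf _ _ (fun k j => by positivity) (hmono z) (hlim z)

end Nonlinearity

/-! ### Monotone iteration in L² -/

section Iteration

variable {X : Type*} [MeasurableSpace X] {μ : Measure X} [IsFiniteMeasure μ]

/-- Dominated convergence in `L²` for uniformly bounded sequences. -/
theorem tendsto_Lp_two_of_ae_tendsto {h : ℕ → Lp ℝ 2 μ} {h' : Lp ℝ 2 μ} {C : ℝ}
    (hC : ∀ k, ∀ᵐ x ∂μ, |h k x| ≤ C)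
    (hlim : ∀ᵐ x ∂μ, Tendsto (fun k => h k x) atTop (𝓝 (h' x))) : Tendsto h atTop (𝓝 h') := by
  have hC' : ∀ᵐ x ∂μ, |h' x| ≤ C := by
    filter_upwards [hlim, ae_all_iff.2 hC] with x hx hxC
    exact le_of_tendsto' hx.abs hxC
  rw [tendsto_iff_norm_sub_tendsto_zero]
  have hsq : Tendsto (fun k => ‖h k - h'‖ ^ 2) atTop (𝓝 0) := by
    have heq : ∀ k, ‖h k - h'‖ ^ 2 = ∫ x, (h k x - h' x) ^ 2 ∂μ := fun k => by
      rw [← real_inner_self_eq_norm_sq, L2.inner_def]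
      refine integral_congr_ae ?_
      filter_upwards [Lp.coeFn_sub (h k) h'] with x hx
      rw [hx, Pi.sub_apply, sq]
      rfl
    simp only [heq]
    rw [← integral_zero X ℝ (μ := μ)]
    refine tendsto_integral_of_dominated_convergence (fun _ => (2 * C) ^ 2) (fun k => ?_)
      (integrable_const _) (fun k => ?_) ?_
    · exact ((Lp.aestronglyMeasurable _).sub (Lp.aestronglyMeasurable _)).pow 2
    · filter_upwards [hC k, hC'] with x h1 h2
      rw [Real.norm_eq_abs, abs_of_nonneg (sq_nonneg _)]
      refine sq_le_sq' ?_ ?_ <;> linarith [abs_le.1 h1, abs_le.1 h2]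
    · filter_upwards [hlim] with x hx
      simpa using (hx.sub_const (h' x)).pow 2
  have := hsq.sqrt
  simpa using this

/-- Monotone iteration from a subsolution for a system `u_l = S (lam_l f_l(u))` with `S` a monotone
operator. -/
theorem exists_solution_of_monotone_iteration {n : ℕ}
    {f : Fin (n + 1) → (Fin (n + 1) → ℝ) → ℝ} (hmono : Cooperative f)
    (hcont : MonotoneLeftContinuous f) {lam : Fin (n + 1) → X → ℝ}
    (hlam : ∀ l, AEStronglyMeasurable (lam l) μ) {L M B : ℝ} (hM : 0 ≤ M)
    (hlam0 : ∀ l, ∀ᵐ x ∂μ, 0 ≤ lam l x) (hlamL : ∀ l, ∀ᵐ x ∂μ, lam l x ≤ L)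
    (hf0 : ∀ l z, 0 ≤ z → 0 ≤ f l z) (hfB : ∀ l z, 0 ≤ z → (∀ j, z j ≤ M) → f l z ≤ B)
    (S : Lp ℝ 2 μ →L[ℝ] Lp ℝ 2 μ) (hS : ∀ g, 0 ≤ g → 0 ≤ S g)
    (hSM : ∀ g : Lp ℝ 2 μ, (∀ᵐ x ∂μ, g x ≤ L * B) → ∀ᵐ x ∂μ, S g x ≤ M)
    {V : Lp ℝ 2 μ} (hV0 : ∀ᵐ x ∂μ, 0 ≤ V x) (hVM : ∀ᵐ x ∂μ, V x ≤ M)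
    (hV : ∀ l, ∃ g : Lp ℝ 2 μ, (∀ᵐ x ∂μ, g x ≤ lam l x * f l fun _ => V x) ∧ V ≤ S g) :
    ∃ U : Fin (n + 1) → Lp ℝ 2 μ, ∀ l, V ≤ U l ∧ (∀ᵐ x ∂μ, 0 ≤ U l x) ∧ (∀ᵐ x ∂μ, U l x ≤ M) ∧
      ∃ g : Lp ℝ 2 μ, (∀ᵐ x ∂μ, g x = lam l x * f l fun j => U j x) ∧
        U l = S g := by
  -- Truncation to [0, M] defines the iteration map on all of L² while keeping it monotone; it
  -- changes nothing on the iterates, whose values already lie in [0, M].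
  let clamp : (Fin (n + 1) → ℝ) → Fin (n + 1) → ℝ := fun z => (z ⊓ fun _ => M) ⊔ 0
  have hclamp0 : ∀ z, 0 ≤ clamp z := fun z => le_sup_right
  have hclampM : ∀ z j, clamp z j ≤ M := fun z j => sup_le inf_le_right hM
  have hclamp_mono : Monotone clamp := fun z z' h => sup_le_sup_right (inf_le_inf_right _ h) _
  have hclamp_id : ∀ z, 0 ≤ z → (∀ j, z j ≤ M) → clamp z = z := fun z h0 h1 => by
    have h2 : z ⊓ (fun _ => M) = z := inf_eq_left.2 h1
    simp only [clamp, h2, sup_eq_left.2 h0]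
  have hclamp_meas : Measurable fun z : Fin (n + 1) → ℝ => z ⊓ fun _ => M :=
    measurable_pi_lambda _ fun j => (measurable_pi_apply j).inf measurable_const
  let G : Fin (n + 1) → (Fin (n + 1) → X → ℝ) → X → ℝ :=
    fun l u x => lam l x * f l (clamp fun j => u j x)
  have hGle : ∀ l u, ∀ᵐ x ∂μ, |G l u x| ≤ L * B := fun l u => by
    filter_upwards [hlam0 l, hlamL l] with x h0 hL
    have h1 := hf0 l _ (hclamp0 fun j => u j x)
    rw [abs_of_nonneg (mul_nonneg h0 h1)]
    exact mul_le_mul hL (hfB l _ (hclamp0 _) (hclampM _)) h1 (h0.trans hL)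
  have hG : ∀ l u, (∀ j, AEStronglyMeasurable (u j) μ) → MemLp (G l u) 2 μ := fun l u hu => by
    refine MemLp.of_bound ((hlam l).mul ?_) (L * B) (hGle l u)
    refine AEMeasurable.aestronglyMeasurable ?_
    exact ((measurable_comp_sup_zero (hcont l)).comp hclamp_meas).comp_aemeasurable
      (aemeasurable_pi_lambda _ fun j => (hu j).aemeasurable)
  let T : (Fin (n + 1) → Lp ℝ 2 μ) → Fin (n + 1) → Lp ℝ 2 μ := fun U l =>
    S ((hG l (fun j => U j) fun j => Lp.aestronglyMeasurable _).toLp)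
  have hSmono : Monotone S := fun g g' h => by
    rw [← sub_nonneg, ← map_sub]
    exact hS _ (sub_nonneg.2 h)
  have hT : Monotone T := fun U U' h l => by
    refine hSmono ((Lp.coeFn_le _ _).1 ?_)
    have h' : ∀ᵐ x ∂μ, ∀ j, U j x ≤ U' j x := ae_all_iff.2 fun j => (Lp.coeFn_le _ _).2 (h j)
    filter_upwards [h', hlam0 l,
      (hG l (fun j => U j) fun j => Lp.aestronglyMeasurable _).coeFn_toLp,
      (hG l (fun j => U' j) fun j => Lp.aestronglyMeasurable _).coeFn_toLp] with x h1 h2 h3 h4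
    rw [h3, h4]
    exact mul_le_mul_of_nonneg_left
      (hmono l (hclamp0 _) (hclamp0 _) (hclamp_mono h1)) h2
  have hT0 : ∀ U l, ∀ᵐ x ∂μ, 0 ≤ T U l x := fun U l => by
    refine (Lp.coeFn_nonneg _).2 (hS _ ((Lp.coeFn_nonneg _).1 ?_))
    filter_upwards [hlam0 l,
      (hG l (fun j => U j) fun j => Lp.aestronglyMeasurable _).coeFn_toLp] with x h2 h3
    rw [h3]
    exact mul_nonneg h2 (hf0 l _ (hclamp0 _))
  have hTM : ∀ U l, ∀ᵐ x ∂μ, T U l x ≤ M := fun U l => by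
    refine hSM _ ?_
    filter_upwards [hGle l fun j => U j,
      (hG l (fun j => U j) fun j => Lp.aestronglyMeasurable _).coeFn_toLp] with x h2 h3
    rw [h3]
    exact (le_abs_self _).trans h2
  -- V is a subsolution; together with monotonicity of T this makes the whole sequence of iterates
  -- nondecreasing.
  have hVT : (fun _ => V) ≤ T fun _ => V := fun l => by
    obtain ⟨g, hg, hgV⟩ := hV l
    refine hgV.trans (hSmono ((Lp.coeFn_le _ _).1 ?_))
    filter_upwards [hg, hV0, hVM,
      (hG l (fun _ => V) fun j => Lp.aestronglyMeasurable _).coeFn_toLp] with x h1 h2 h3 h4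
    rw [h4]
    simp only [G]
    rwa [hclamp_id _ (fun _ => h2) fun _ => h3]
  let U : ℕ → Fin (n + 1) → Lp ℝ 2 μ := fun k => T^[k] fun _ => V
  have hU0 : U 0 = fun _ => V := rfl
  have hUs : ∀ k, U (k + 1) = T (U k) := fun k => Function.iterate_succ_apply' T k _
  have hUmono : Monotone U := hT.monotone_iterate_of_le_map hVT
  have hUb0 : ∀ k l, ∀ᵐ x ∂μ, 0 ≤ U k l x := fun k l => by
    cases k with
    | zero => exact hV0
    | succ k => rw [hUs]; exact hT0 _ l
  have hUbM : ∀ k l, ∀ᵐ x ∂μ, U k l x ≤ M := fun k l => by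
    cases k with
    | zero => exact hVM
    | succ k => rw [hUs]; exact hTM _ l
  have hae : ∀ᵐ x ∂μ, ∀ l k, 0 ≤ U k l x ∧ U k l x ≤ M ∧ U k l x ≤ U (k + 1) l x := by
    refine ae_all_iff.2 fun l => ae_all_iff.2 fun k => ?_
    filter_upwards [hUb0 k l, hUbM k l, (Lp.coeFn_le _ _).2 (hUmono k.le_succ l)] with x h1 h2 h3
    exact ⟨h1, h2, h3⟩
  let u : Fin (n + 1) → X → ℝ := fun l x => ⨆ k, U k l x
  have hlim : ∀ᵐ x ∂μ, ∀ l, Tendsto (fun k => U k l x) atTop (𝓝 (u l x)) := by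
    filter_upwards [hae] with x hx l
    exact tendsto_atTop_ciSup (monotone_nat_of_le_succ fun k => (hx l k).2.2)
      ⟨M, by rintro _ ⟨k, rfl⟩; exact (hx l k).2.1⟩
  have hum : ∀ l, AEStronglyMeasurable (u l) μ := fun l =>
    aestronglyMeasurable_of_tendsto_ae atTop (fun k => Lp.aestronglyMeasurable (U k l))
      (hlim.mono fun x hx => hx l)
  have hu0 : ∀ᵐ x ∂μ, ∀ l, 0 ≤ u l x := by
    filter_upwards [hae, hlim] with x hx hl l
    exact ge_of_tendsto' (hl l) fun k => (hx l k).1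
  have huM : ∀ᵐ x ∂μ, ∀ l, u l x ≤ M := by
    filter_upwards [hae, hlim] with x hx hl l
    exact le_of_tendsto' (hl l) fun k => (hx l k).2.1
  have huLp : ∀ l, MemLp (u l) 2 μ := fun l => by
    refine MemLp.of_bound (hum l) M ?_
    filter_upwards [hu0, huM] with x h0 h1
    rw [Real.norm_eq_abs, abs_of_nonneg (h0 l)]
    exact h1 l
  have hucoe : ∀ᵐ x ∂μ, ∀ l, (huLp l).toLp (u l) x = u l x :=
    ae_all_iff.2 fun l => (huLp l).coeFn_toLp
  have hUlim : ∀ l, Tendsto (fun k => U k l) atTop (𝓝 ((huLp l).toLp (u l))) := fun l => by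
    refine tendsto_Lp_two_of_ae_tendsto (C := M) (fun k => ?_) ?_
    · filter_upwards [hae] with x hx
      rw [abs_of_nonneg (hx l k).1]
      exact (hx l k).2.1
    · filter_upwards [hlim, hucoe] with x hx h
      rw [h]
      exact hx l
  have hGlim : ∀ l, Tendsto (fun k =>
      (hG l (fun j => U k j) fun j => Lp.aestronglyMeasurable _).toLp) atTop
      (𝓝 ((hG l u hum).toLp)) := fun l => by
    refine tendsto_Lp_two_of_ae_tendsto (C := L * B) (fun k => ?_) ?_
    · filter_upwards [hGle l fun j => U k j,
        (hG l (fun j => U k j) fun j => Lp.aestronglyMeasurable _).coeFn_toLp] with x h1 h2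
      rwa [h2]
    · have hcoe : ∀ᵐ x ∂μ, ∀ k, (hG l (fun j => U k j) fun j =>
          Lp.aestronglyMeasurable _).toLp _ x = G l (fun j => U k j) x :=
        ae_all_iff.2 fun k => (hG l (fun j => U k j) fun j => Lp.aestronglyMeasurable _).coeFn_toLp
      filter_upwards [hcoe, (hG l u hum).coeFn_toLp, hae, hlim, hu0, huM] with x h1 h2 h3 h4 h5 h6
      simp only [h1, h2, G]
      refine Tendsto.const_mul _ ?_
      rw [hclamp_id _ h5 h6]
      have h7 : ∀ k, clamp (fun j => U k j x) = fun j => U k j x := fun k =>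
        hclamp_id _ (fun j => (h3 j k).1) fun j => (h3 j k).2.1
      simp only [h7]
      -- Left continuity suffices because the iterates increase pointwise.
      exact hcont l _ _ (fun k j => (h3 j k).1)
        (monotone_nat_of_le_succ fun k j => (h3 j k).2.2) (tendsto_pi_nhds.2 h4)
  refine ⟨fun l => (huLp l).toLp (u l), fun l => ⟨?_, ?_, ?_, (hG l u hum).toLp, ?_, ?_⟩⟩
  · exact ge_of_tendsto' (hUlim l) fun k => hUmono (Nat.zero_le k) l
  · filter_upwards [hu0, hucoe] with x h1 h2
    rw [h2]
    exact h1 l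
  · filter_upwards [huM, hucoe] with x h1 h2
    rw [h2]
    exact h1 l
  · filter_upwards [hu0, huM, hucoe, (hG l u hum).coeFn_toLp] with x h1 h2 h3 h4
    simp only [h3, h4, G]
    rw [hclamp_id _ h1 h2]
  -- The shifted sequence Uₖ₊₁ = T(Uₖ) has two limits, u and S(λ_l f_l(u)).
  · refine tendsto_nhds_unique ((tendsto_add_atTop_iff_nat 1).2 (hUlim l)) ?_
    simp only [hUs]
    exact (S.continuous.tendsto _).comp (hGlim l)

end Iteration

/-! ### Constants extracted from the sublinear bounds -/

section Constants

variable {n : ℕ} {f : Fin (n + 1) → (Fin (n + 1) → ℝ) → ℝ}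

theorem SublinearLowerBound.nonneg_zero (hf : SublinearLowerBound f) (l : Fin (n + 1)) :
    0 ≤ f l 0 := by
  obtain ⟨ε₀, A, α, hε₀, hA, -, hα, h⟩ := hf
  refine le_trans (Finset.sum_nonneg fun j _ => ?_) (h l 0 le_rfl fun j => by simpa using hε₀)
  exact mul_nonneg (hA l j) (Real.rpow_nonneg (abs_nonneg _) _)

/-- By sublinearity, `k f_l` maps `[0, M]^{n+1}` into `[0, M]` for some large `M`. -/
theorem SublinearGrowth.exists_invariant_bound (hf : SublinearGrowth f) (k : ℝ) :
    ∃ M B : ℝ, 1 ≤ M ∧ k * B ≤ M ∧ ∀ l z, 0 ≤ z → (∀ j, z j ≤ M) → f l z ≤ B := by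
  obtain ⟨-, C, p, A, hp, hA, h⟩ := hf
  -- The growth bound at height M, divided by M, tends to 0 because every p is below 1. Summing over
  -- l as well gives one B for all components; absolute values are taken since C may be negative.
  have hlim : Tendsto (fun M : ℝ => k * (∑ l, ∑ j, |C l j| * M ^ (-(1 - p l j)) + A * M⁻¹))
      atTop (𝓝 (k * (∑ l : Fin (n + 1), ∑ j : Fin (n + 1), |C l j| * 0 + A * 0))) := by
    refine Tendsto.const_mul _ (Tendsto.add ?_ (tendsto_inv_atTop_zero.const_mul _))
    refine tendsto_finsetSum _ fun l _ => tendsto_finsetSum _ fun j _ => Tendsto.const_mul _ ?_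
    exact tendsto_rpow_neg_atTop (by linarith [(hp l j).2])
  simp only [mul_zero, Finset.sum_const_zero, add_zero] at hlim
  obtain ⟨M, hM, hM1⟩ := ((hlim.eventually (gt_mem_nhds one_pos)).and (eventually_ge_atTop 1)).exists
  have hM0 : 0 < M := by linarith
  refine ⟨M, ∑ l, ∑ j, |C l j| * M ^ p l j + A, hM1, ?_, fun l z hz hzM => ?_⟩
  · have h1 : ∀ l j, M ^ p l j = M ^ (-(1 - p l j)) * M := fun l j => by
      rw [← Real.rpow_add_one hM0.ne']
      congr 1
      ring
    have h2 : ∑ l, ∑ j, |C l j| * M ^ p l j + A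
        = (∑ l, ∑ j, |C l j| * M ^ (-(1 - p l j)) + A * M⁻¹) * M := by
      rw [add_mul, Finset.sum_mul, mul_assoc, inv_mul_cancel₀ hM0.ne', mul_one]
      congr 1
      refine Finset.sum_congr rfl fun l _ => ?_
      rw [Finset.sum_mul]
      exact Finset.sum_congr rfl fun j _ => by rw [h1, mul_assoc]
    rw [h2, ← mul_assoc]
    exact mul_le_of_le_one_left hM0.le hM.le
  · refine (le_abs_self _).trans ((h l z hz).trans ?_)
    refine add_le_add ?_ le_rfl
    calc ∑ j, C l j * |z j| ^ p l j ≤ ∑ j, |C l j| * M ^ p l j := by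
          refine Finset.sum_le_sum fun j _ => ?_
          have hj : |z j| ≤ M := by rw [abs_of_nonneg (hz j)]; exact hzM j
          exact mul_le_mul (le_abs_self _) (Real.rpow_le_rpow (abs_nonneg _) hj (hp l j).1.le)
            (Real.rpow_nonneg (abs_nonneg _) _) (abs_nonneg _)
      _ ≤ ∑ l, ∑ j, |C l j| * M ^ p l j :=
          Finset.single_le_sum (f := fun l => ∑ j, |C l j| * M ^ p l j)
            (fun l _ => Finset.sum_nonneg fun j _ =>
              mul_nonneg (abs_nonneg _) (Real.rpow_nonneg hM0.le _)) (Finset.mem_univ l)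

/-- Near the origin, `f_l` dominates every linear function on the diagonal. -/
theorem SublinearLowerBound.exists_linear_le (hf : SublinearLowerBound f) {K Λ : ℝ}
    (hK : 0 ≤ K) (hΛ : 0 < Λ) :
    ∃ ε : ℝ, 0 < ε ∧ ε ≤ 1 ∧ ∀ l t, 0 ≤ t → t ≤ ε → K * t ≤ Λ * f l fun _ => t := by
  obtain ⟨ε₀, A, α, hε₀, hA, hA', hα, h⟩ := hf
  choose j hj using hA'
  have hApos : ∀ l, 0 < A l (j l) := fun l => (hA l (j l)).lt_of_ne' (hj l)
  -- A single nonzero coefficient per component suffices: K t = K t^(1-α) t^α ≤ Λ A t^α once K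
  -- ε^(1-α) ≤ Λ A and t ≤ ε.
  have hev : ∀ᶠ ε : ℝ in 𝓝 0, ∀ l, K * ε ^ (1 - α l (j l)) < Λ * A l (j l) := by
    refine eventually_all.2 fun l => ?_
    have h1 : 0 < 1 - α l (j l) := by linarith [(hα l (j l)).2]
    have h2 : Tendsto (fun ε : ℝ => K * ε ^ (1 - α l (j l))) (𝓝 0) (𝓝 0) :=
      (continuous_const.mul (Real.continuous_rpow_const h1.le)).tendsto' _ _
        (by simp [Real.zero_rpow h1.ne'])
    exact h2.eventually (gt_mem_nhds (mul_pos hΛ (hApos l)))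
  have hev2 : ∀ᶠ ε : ℝ in 𝓝[>] 0, ε < ε₀ ∧ ε < 1 :=
    nhdsWithin_le_nhds ((gt_mem_nhds hε₀).and (gt_mem_nhds one_pos))
  obtain ⟨ε, ⟨h1, h2, h3⟩, hε : 0 < ε⟩ :=
    (((hev.filter_mono nhdsWithin_le_nhds).and hev2).and self_mem_nhdsWithin).exists
  refine ⟨ε, hε, h3.le, fun l t ht htε => ?_⟩
  have h4 : A l (j l) * t ^ α l (j l) ≤ f l fun _ => t := by
    refine le_trans ?_ (h l (fun _ => t) (fun _ => ht) fun _ => ?_)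
    · refine le_trans (le_of_eq ?_) (Finset.single_le_sum
        (f := fun i => A l i * |t| ^ α l i) (fun i _ => ?_) (Finset.mem_univ (j l)))
      · simp only [abs_of_nonneg ht]
      · exact mul_nonneg (hA l i) (Real.rpow_nonneg (abs_nonneg _) _)
    · rw [abs_of_nonneg ht]
      linarith
  refine le_trans ?_ (mul_le_mul_of_nonneg_left h4 hΛ.le)
  rcases ht.eq_or_lt with rfl | htpos
  · rw [Real.zero_rpow (hα l (j l)).1.ne']
    simp
  · have h5 : t = t ^ (1 - α l (j l)) * t ^ α l (j l) := by
      rw [← Real.rpow_add htpos]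
      simp
    have h6 : t ^ (1 - α l (j l)) ≤ ε ^ (1 - α l (j l)) :=
      Real.rpow_le_rpow ht htε (by linarith [(hα l (j l)).2])
    calc K * t = K * t ^ (1 - α l (j l)) * t ^ α l (j l) := by rw [mul_assoc, ← h5]
      _ ≤ Λ * A l (j l) * t ^ α l (j l) := by
        refine mul_le_mul_of_nonneg_right ?_ (Real.rpow_nonneg ht _)
        exact (mul_le_mul_of_nonneg_left h6 hK).trans (h1 l).le
      _ = _ := mul_assoc _ _ _

end Constants

/-! ### The existence theorem -/

theorem exists_forall_ae_le_of_memLp_top {X ι : Type*} [Fintype ι] [MeasurableSpace X]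
    {μ : Measure X} {h : ι → X → ℝ} (hh : ∀ i, MemLp (h i) ⊤ μ) :
    ∃ L, 0 ≤ L ∧ ∀ i, ∀ᵐ x ∂μ, h i x ≤ L := by
  refine ⟨∑ i, (eLpNormEssSup (h i) μ).toReal, by positivity, fun i => ?_⟩
  have hi : eLpNormEssSup (h i) μ ≠ ⊤ := by
    rw [← eLpNorm_exponent_top]
    exact (hh i).2.ne
  filter_upwards [ae_le_eLpNormEssSup (f := h i) (μ := μ)] with x hx
  have h1 : |h i x| ≤ (eLpNormEssSup (h i) μ).toReal := by
    rw [← Real.norm_eq_abs, ← toReal_enorm]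
    exact ENNReal.toReal_mono hi hx
  refine (le_abs_self _).trans (h1.trans ?_)
  exact Finset.single_le_sum (f := fun i => (eLpNormEssSup (h i) μ).toReal)
    (fun i _ => ENNReal.toReal_nonneg) (Finset.mem_univ i)

theorem theorem1 {N n : ℕ} (hN : 1 ≤ N)
    (Ω : Opens (EuclideanSpace ℝ (Fin N)))
    (hΩ_conn : IsConnected (Ω : Set (EuclideanSpace ℝ (Fin N))))
    (hΩ_bdd : Bornology.IsBounded (Ω : Set (EuclideanSpace ℝ (Fin N))))
    (f : Fin (n + 1) → (Fin (n + 1) → ℝ) → ℝ)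
    (hfa : SublinearGrowth f) (hfb : SublinearLowerBound f)
    (hfc : Cooperative f) (hfd : MonotoneLeftContinuous f)
    (lam : Fin (n + 1) → EuclideanSpace ℝ (Fin N) → ℝ)
    (hlam_bdd : ∀ l, MemLp (lam l) ∞ (volume.restrict (Ω : Set (EuclideanSpace ℝ (Fin N)))))
    (hlam_nonneg : ∀ l, 0 ≤ᵐ[volume.restrict (Ω : Set (EuclideanSpace ℝ (Fin N)))] lam l)
    (q : EuclideanSpace ℝ (Fin N)) (hq : q ∈ Ω) (ρ Λ : ℝ) (hρ : 0 < ρ) (hΛ : 0 < Λ)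
    (hlam_lower : ∀ l, ∀ᵐ x ∂(volume.restrict (Ω : Set (EuclideanSpace ℝ (Fin N)))),
      x ∈ Metric.ball q (2 * ρ) → Λ ≤ lam l x) :
    ∃ u : Fin (n + 1) → EuclideanSpace ℝ (Fin N) → ℝ,
      IsWeakSolution Ω lam f u ∧
      (∀ l, 0 ≤ᵐ[volume.restrict (Ω : Set (EuclideanSpace ℝ (Fin N)))] u l) ∧
      (∀ l, ¬ u l =ᵐ[volume.restrict (Ω : Set (EuclideanSpace ℝ (Fin N)))] 0) := by
  have hfin : IsFiniteMeasure (volume.restrict (Ω : Set (EuclideanSpace ℝ (Fin N)))) :=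
    ⟨by simpa using hΩ_bdd.measure_lt_top⟩
  obtain ⟨R, hR⟩ := isBounded_iff_forall_norm_le.1 hΩ_bdd
  obtain ⟨L, hL0, hL⟩ := exists_forall_ae_le_of_memLp_top hlam_bdd
  -- A right-hand side at most L B produces a solution at most L B R², which must not exceed M.
  obtain ⟨M, B, hM1, hMB, hfB⟩ := hfa.exists_invariant_bound (R ^ 2 * L)
  obtain ⟨S, hSmem, hS⟩ := exists_solution_operator hN hΩ_bdd
  obtain ⟨v, d, K, hK0, hd, hv0, hv1, hvq, hdK, hvout, hvd⟩ :=
    exists_bump_neg_laplacian_le hq (show 0 < 2 * ρ by positivity)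
  obtain ⟨ε, hε0, hε1, hε⟩ := hfb.exists_linear_le hK0 hΛ
  have hf0 : ∀ l z, 0 ≤ z → 0 ≤ f l z := fun l z hz =>
    (hfb.nonneg_zero l).trans (hfc l (Set.mem_Ici.2 le_rfl) hz hz)
  have hB0 : 0 ≤ B := (hf0 0 0 le_rfl).trans (hfB 0 0 le_rfl fun _ => by
    simp only [Pi.zero_apply]; linarith)
  -- By uniqueness v is the image of its own -Δv under S, so εv has the form S g required of the
  -- subsolution.
  have hSv : S hd.toLp = testJet Ω v := by
    refine eq_of_weak_equation hN hΩ_bdd (hSmem _) (testJet_mem v) fun φ => ?_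
    rw [hS, inner_testJet_fst, real_inner_comm, real_inner_comm, inner_testJet_snd]
    have h1 : ∫ x in (Ω : Set (EuclideanSpace ℝ (Fin N))), hd.toLp d x * φ x
        = ∫ x in (Ω : Set (EuclideanSpace ℝ (Fin N))), d x * φ x := by
      refine integral_congr_ae ?_
      filter_upwards [hd.coeFn_toLp] with x hx
      rw [hx]
    rw [h1, ← hvd]
    refine integral_congr_ae ?_
    filter_upwards [coeFn_testJet_snd v] with x hx
    rw [hx]
  have hVx : ∀ᵐ x ∂(volume.restrict (Ω : Set (EuclideanSpace ℝ (Fin N)))),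
      (ε • (testJet Ω v).fst) x = ε * v x := by
    filter_upwards [Lp.coeFn_smul ε (testJet Ω v).fst, coeFn_testJet_fst v] with x h1 h2
    rw [h1, Pi.smul_apply, h2, smul_eq_mul]
  obtain ⟨U, hU⟩ := exists_solution_of_monotone_iteration hfc hfd
    (fun l => (hlam_bdd l).aestronglyMeasurable) (zero_le_one.trans hM1) hlam_nonneg hL hf0 hfB
    ((WithLp.fstL 2 ℝ _ _).comp S)
    (fun g hg => fst_nonneg_of_weak_equation hN hΩ_bdd (hSmem g) (hS g) hg)
    (fun g hg => by
      filter_upwards [fst_le_of_weak_equation hN hR (hSmem g) (hS g) (mul_nonneg hL0 hB0) hg]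
        with x hx
      exact hx.trans (by linarith))
    (V := ε • (testJet Ω v).fst)
    (by
      filter_upwards [hVx] with x hx
      rw [hx]
      exact mul_nonneg hε0.le (hv0 x))
    (by
      filter_upwards [hVx] with x hx
      rw [hx]
      exact (mul_le_one₀ hε1 (hv0 x) (hv1 x)).trans hM1)
    (fun l => by
      refine ⟨ε • hd.toLp, ?_, ?_⟩
      · filter_upwards [hVx, Lp.coeFn_smul ε (hd.toLp d), hd.coeFn_toLp, hlam_nonneg l,
          hlam_lower l] with x h1 h2 h3 h4 h5
        rw [h1, h2, Pi.smul_apply, h3, smul_eq_mul]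
        have hnn : 0 ≤ ε * v x := mul_nonneg hε0.le (hv0 x)
        have h6 : ε * d x ≤ K * (ε * v x) := by
          have := mul_le_mul_of_nonneg_left (hdK x) hε0.le
          linarith
        -- Inside the ball λ_l ≥ Λ absorbs K εv; outside it v = 0, and -Δ(εv) ≤ 0 ≤ λ_l f_l.
        by_cases hx : x ∈ Metric.ball q (2 * ρ)
        · have h7 := hε l (ε * v x) hnn (mul_le_of_le_one_right hε0.le (hv1 x))
          exact h6.trans (h7.trans (mul_le_mul_of_nonneg_right (h5 hx) (hf0 l _ fun _ => hnn)))
        · rw [hvout x hx] at h6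
          refine h6.trans ?_
          rw [mul_zero, mul_zero]
          exact mul_nonneg h4 (hf0 l _ fun _ => hnn)
      · refine le_of_eq ?_
        rw [map_smul, ContinuousLinearMap.comp_apply, hSv]
        rfl)
  choose hVU hU0 hUM g hg hUS using hU
  refine ⟨fun l => U l, ⟨fun l => (S (g l)).snd, fun l => ⟨?_, ?_, fun φ => ?_⟩⟩, hU0, fun l h => ?_⟩
  · simp only [hUS]
    exact isW012_of_mem_sobolevW0 (hSmem (g l))
  · refine memLp_top_of_bound (Lp.aestronglyMeasurable _) M ?_
    filter_upwards [hU0 l, hUM l] with x h0 h1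
    rwa [Real.norm_eq_abs, abs_of_nonneg h0]
  · have hae : (fun x => g l x * φ x) =ᵐ[volume.restrict (Ω : Set (EuclideanSpace ℝ (Fin N)))]
        fun x => lam l x * f l (fun j => U j x) * φ x := by
      filter_upwards [hg l] with x hx
      rw [hx]
    refine ⟨((Lp.memLp (g l)).integrable_mul (φ.memLp 2)).congr hae, ?_⟩
    rw [← integral_congr_ae hae, ← inner_testJet_fst, ← inner_testJet_snd, hS]
  · have h1 : ∀ᵐ x ∂(volume.restrict (Ω : Set (EuclideanSpace ℝ (Fin N)))), v x ≤ 0 := by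
      filter_upwards [(Lp.coeFn_le _ _).2 (hVU l), hVx, h] with x h1 h2 h3
      rw [h2, h3] at h1
      by_contra! h4
      exact absurd h1 (not_le.2 (mul_pos hε0 h4))
    -- If U_l vanished a.e., so would v on Ω; but v > 0 on an open set containing q, which has
    -- positive measure.
    have h2 : IsOpen ((Ω : Set (EuclideanSpace ℝ (Fin N))) ∩ {x | 0 < v x}) :=
      Ω.2.inter (isOpen_lt continuous_const v.continuous)
    refine (h2.measure_pos volume ⟨q, hq, hvq⟩).ne' ?_
    refine measure_mono_null (fun x hx => ?_)
      (ae_iff.1 ((ae_restrict_iff' Ω.isOpen.measurableSet).1 h1))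
    exact fun h => absurd (h hx.1) (not_le.2 hx.2)
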